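/- Let $K$ be a field of characteristic $0$ (e.g. $K=\mathbb{C}$) and let $(\mathfrak{g},\delta)$ be a finite dimensional Lie bialgebra over $K$. Let $\mathfrak{l}\subset\mathfrak{g}$ be a Lie subbialgebra and $\mathfrak{g}=\mathfrak{l}\oplus\mathfrak{u}$ a decomposition such that $[\mathfrak{l},\mathfrak{u}]\subset\mathfrak{u}$ and $\delta(\mathfrak{u})\subset(\mathfrak{l}\otimes\mathfrak{u})\oplus(\mathfrak{u}\otimes\mathfrak{l})\oplus(\mathfrak{u}\otimes\mathfrak{u})$. Assume that the splitting is nondegenerate: for generic $\lambda\in\mathfrak{l}^*$ the pairing $\mathfrak{u}\times\mathfrak{u}\to K$, $(u,v)\mapsto\lambda([u,v]_{\mathfrak{l}})$ is nondegenerate, where $z\mapsto z_{\mathfrak{l}}$ is the projection on $\mathfrak{l}$ parallel to $\mathfrak{u}$. Equip $\mathfrak{l}^*$, $\mathfrak{g}^*$ with the Lie brackets dual to the cobrackets; the splitting identifies $\mathfrak{l}^*$ with a Lie subalgebra of $\mathfrak{g}^*$ (extension of functionals by $0$ on $\mathfrak{u}$). Let $K[[L^*]]=U(\mathfrak{l}^*)^*$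 be the function algebra of the formal group $L^*$ of $\mathfrak{l}^*$. The group $L^*$ acts by $\mathrm{Ad}$ on the Drinfeld doubles $\mathfrak{d}(\mathfrak{g})=\mathfrak{g}\oplus\mathfrak{g}^*$ and $\mathfrak{d}(\mathfrak{l})=\mathfrak{l}\oplus\mathfrak{l}^*$. For $\varepsilon\in\mathfrak{l}^*$ set $(\mathbf{L}_\varepsilon f)(x)=\frac{d}{dt}\big|_{t=0}f(e^{-t\varepsilon}x)$ and $(\mathbf{R}_\varepsilon f)(x)=\frac{d}{dt}\big|_{t=0}f(xe^{t\varepsilon})$, and for $a\in\mathfrak{l}$ let $(\mathrm{dress}^L_a f)(x)=-(\mathbf{R}_{(\mathrm{Ad}(x^{-1})(a))_{\mathfrak{l}^*}}f)(x)$ be the left dressing action. These are derivations of $K[[L^*]]$, and they extend to its localizations. Let $\mathrm{d}^L(f)=-\sum_i e_i\otimes\mathbf{L}_{\varepsilon^i}(f)$, where $(e_i),(\varepsilon^i)$ are dual bases of $\mathfrak{l},\mathfrak{l}^*$, and $\mathrm{d}^L(a\otimes b\otimes \ell)=a\otimes b\otimes\mathrm{d}^L(\ell)$. Let $\mathrm{Alt}$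 denote the sum of the three cyclic permutations of a 3-tensor, let $\mathrm{CYB}(\rho)=[\rho^{1,2},\rho^{1,3}]+[\rho^{1,2},\rho^{2,3}]+[\rho^{1,3},\rho^{2,3}]$, and let $\wedge^2(V)\subset V^{\otimes 2}$ be the space of antisymmetric tensors. For $u,v\in\mathfrak{u}$ let $\omega(u,v)\in K[[L^*]]$ be the function $$x\mapsto \omega_x(u,v)=\big\langle(\mathrm{Ad}(x^{-1})(u))_{\mathfrak{g}},(\mathrm{Ad}(x^{-1})(v))_{\mathfrak{g}^*}\big\rangle ,$$ and let $P=\det\big(\omega(u_i,u_j)\big)_{i,j}\in K[[L^*]]$, where $(u_i)$ is a basis of $\mathfrak{u}$ ($P$ is well defined up to a nonzero scalar). Then $P\neq 0$, and there is a unique $\sigma=\sum_\alpha a_\alpha\otimes b_\alpha\otimes\ell_\alpha\in\mathfrak{u}\otimes\mathfrak{u}\otimes K[[L^*]][1/P]$ inverse to $\omega$, i.e. such that $\sum_\alpha a_\alpha\otimes\omega(v,b_\alpha)\ell_\alpha=v\otimes 1$ for all $v\in\mathfrak{u}$. This $\sigma$ lies in $\wedge^2(\mathfrak{u})\otimes K[[L^*]][1/P]$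 and is a Poisson-Lie dynamical $r$-matrix for $(L^*,\mathfrak{g},0)$, that is: (a) $\mathrm{dress}^L_a(\sigma)+[a\otimes 1+1\otimes a,\sigma]=0$ for all $a\in\mathfrak{l}$; (b) $\mathrm{CYB}(\sigma)+\mathrm{Alt}(\mathrm{d}^L\sigma)+\mathrm{Alt}((\delta\otimes\mathrm{id})(\sigma))=0$. -/

import Mathlib

open scoped TensorProduct

noncomputable section

namespace PLDyn

/-! ### Tensor operations -/

section Tensor

variable (K : Type*) [Field K] (V : Type*) [AddCommGroup V] [Module K V]

/-- The cyclic permutation `a ⊗ b ⊗ c ↦ b ⊗ c ⊗ a`. -/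
def cyc : V ⊗[K] (V ⊗[K] V) →ₗ[K] V ⊗[K] (V ⊗[K] V) :=
  (TensorProduct.assoc K V V V).toLinearMap ∘ₗ (TensorProduct.comm K V (V ⊗[K] V)).toLinearMap

/-- The sum of the cyclic permutations of a 3-tensor. -/
def alt : V ⊗[K] (V ⊗[K] V) →ₗ[K] V ⊗[K] (V ⊗[K] V) :=
  LinearMap.id + cyc K V + cyc K V ∘ₗ cyc K V

/-- `∧²(V)`, the space of antisymmetric tensors in `V ⊗ V`. -/
def wedge2 : Submodule K (V ⊗[K] V) :=
  LinearMap.ker ((TensorProduct.comm K V V).toLinearMap + LinearMap.id)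

variable {K V}

/-- For `f : V → V ⊗ V`, the map `f ⊗ id : V ⊗ V → V ⊗ V ⊗ V`. -/
def tensorId (f : V →ₗ[K] V ⊗[K] V) : V ⊗[K] V →ₗ[K] V ⊗[K] (V ⊗[K] V) :=
  (TensorProduct.assoc K V V V).toLinearMap ∘ₗ LinearMap.rTensor V f

theorem cyc_tmul (a b c : V) : cyc K V (a ⊗ₜ (b ⊗ₜ c)) = b ⊗ₜ (c ⊗ₜ a) := rfl

theorem mem_wedge2 {t : V ⊗[K] V} : t ∈ wedge2 K V ↔ TensorProduct.comm K V V t = -t := by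
  simp [wedge2, eq_neg_iff_add_eq_zero]

end Tensor

/-! ### Lie bialgebras -/

/-- A Lie bialgebra structure on a Lie algebra over a field. -/
class LieBialgebra (K g : Type*) [Field K] [LieRing g] [LieAlgebra K g] where
  /-- the cobracket `δ` -/
  cobracket : g →ₗ[K] g ⊗[K] g
  antisymm : ∀ a, cobracket a ∈ wedge2 K g
  coJacobi : ∀ a, alt K g (tensorId cobracket (cobracket a)) = 0
  /-- `δ([a,b]) = [a ⊗ 1 + 1 ⊗ a, δ(b)] + [δ(a), b ⊗ 1 + 1 ⊗ b]`; the bracket of `g` with `g ⊗ g`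
  is the diagonal adjoint action. -/
  cocycle : ∀ a b : g, cobracket ⁅a, b⁆ = ⁅a, cobracket b⁆ - ⁅b, cobracket a⁆

section Double

variable (K g : Type*) [Field K] [LieRing g] [LieAlgebra K g]

/-- The dual space `g^*`, to be equipped with the Lie bracket dual to the cobracket of `g`. -/
def LieDual : Type _ := Module.Dual K g

instance : AddCommGroup (LieDual K g) := inferInstanceAs (AddCommGroup (Module.Dual K g))
instance : Module K (LieDual K g) := inferInstanceAs (Module K (Module.Dual K g))
instance [Module.Finite K g] : Module.Finite K (LieDual K g) :=
  inferInstanceAs (Module.Finite K (Module.Dual K g))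

/-- The vector space `d(g) = g ⊕ g^*`, to be equipped with the bracket of the Drinfeld double. -/
def Double : Type _ := g × LieDual K g

instance : AddCommGroup (Double K g) := inferInstanceAs (AddCommGroup (g × LieDual K g))
instance : Module K (Double K g) := inferInstanceAs (Module K (g × LieDual K g))

variable {K g}

namespace LieDual

/-- The functional underlying an element of `g^*`. -/
def toDual : LieDual K g ≃ₗ[K] Module.Dual K g := LinearEquiv.refl K _

theorem ext {ξ η : LieDual K g} (h : ∀ x, toDual ξ x = toDual η x) : ξ = η :=
  LinearMap.ext h

end LieDual

open LieDual

section contractions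

/-- `a ⊗ b ↦ ξ(a) η(b)`. -/
def ev2 (ξ η : LieDual K g) : g ⊗[K] g →ₗ[K] K :=
  LinearMap.mul' K K ∘ₗ TensorProduct.map (toDual ξ) (toDual η)

/-- `a ⊗ b ↦ ξ(a) b`. -/
def ev1 (ξ : LieDual K g) : g ⊗[K] g →ₗ[K] g :=
  (TensorProduct.lid K g).toLinearMap ∘ₗ LinearMap.rTensor g (toDual ξ)

@[simp] theorem ev2_tmul (ξ η : LieDual K g) (a b : g) :
    ev2 ξ η (a ⊗ₜ b) = toDual ξ a * toDual η b := rfl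

@[simp] theorem ev1_tmul (ξ : LieDual K g) (a b : g) :
    ev1 ξ (a ⊗ₜ b) = toDual ξ a • b := rfl

/-- `a ⊗ b ⊗ c ↦ ξ(a) η(b) c`. -/
def ev12 (ξ η : LieDual K g) : g ⊗[K] (g ⊗[K] g) →ₗ[K] g :=
  ev1 η ∘ₗ (TensorProduct.lid K (g ⊗[K] g)).toLinearMap ∘ₗ
    LinearMap.rTensor (g ⊗[K] g) (toDual ξ)

@[simp] theorem ev12_tmul (ξ η : LieDual K g) (a b c : g) :
    ev12 ξ η (a ⊗ₜ (b ⊗ₜ c)) = (toDual ξ a * toDual η b) • c := by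
  simp [ev12, smul_smul]

end contractions

variable [LieBialgebra K g]

open LieBialgebra

/-- `⟨[ξ,η], x⟩ = ⟨ξ ⊗ η, δ(x)⟩`. -/
instance : Bracket (LieDual K g) (LieDual K g) where
  bracket ξ η := toDual.symm (ev2 ξ η ∘ₗ cobracket)

theorem LieDual.lie_apply (ξ η : LieDual K g) (x : g) :
    toDual ⁅ξ, η⁆ x = ev2 ξ η (cobracket x) := rfl

/-- The component in `g` of the bracket `[x, ξ]` in the double: `(ξ ⊗ id)(δ(x))`. -/
def coadG (x : g) (ξ : LieDual K g) : g := ev1 ξ (cobracket x)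

/-- The component in `g^*` of the bracket `[x, ξ]` in the double: `-ξ ∘ ad(x)`. -/
def coadD (x : g) (ξ : LieDual K g) : LieDual K g :=
  toDual.symm (-(toDual ξ ∘ₗ (LieAlgebra.ad K g x : g →ₗ[K] g)))

@[simp] theorem coadD_apply (x : g) (ξ : LieDual K g) (y : g) :
    toDual (coadD x ξ) y = - toDual ξ ⁅x, y⁆ := rfl

theorem toDual_ev1 (ξ η : LieDual K g) (t : g ⊗[K] g) :
    toDual η (ev1 ξ t) = ev2 ξ η t := by
  induction t with
  | zero => simp
  | tmul a b => simp
  | add s t hs ht => simp [hs, ht]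

theorem comm_cobracket (x : g) :
    TensorProduct.comm K g g (cobracket (K := K) x) = -cobracket x :=
  mem_wedge2.1 (antisymm x)

theorem ev2_comm (ξ η : LieDual K g) (t : g ⊗[K] g) :
    ev2 ξ η (TensorProduct.comm K g g t) = ev2 η ξ t := by
  induction t with
  | zero => simp
  | tmul a b => simp [mul_comm]
  | add s t hs ht => simp [hs, ht]

theorem ev2_cobracket_swap (ξ η : LieDual K g) (x : g) :
    ev2 ξ η (cobracket x) = - ev2 η ξ (cobracket x) := by
  rw [← ev2_comm, comm_cobracket, map_neg]

theorem ev2_add_left (ξ ξ' η : LieDual K g) (t : g ⊗[K] g) :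
    ev2 (ξ + ξ') η t = ev2 ξ η t + ev2 ξ' η t := by
  simp [ev2, TensorProduct.map_add_left]

theorem ev2_add_right (ξ η η' : LieDual K g) (t : g ⊗[K] g) :
    ev2 ξ (η + η') t = ev2 ξ η t + ev2 ξ η' t := by
  simp [ev2, TensorProduct.map_add_right]

theorem ev2_smul_left (c : K) (ξ η : LieDual K g) (t : g ⊗[K] g) :
    ev2 (c • ξ) η t = c * ev2 ξ η t := by
  simp [ev2, TensorProduct.map_smul_left]

theorem ev2_smul_right (c : K) (ξ η : LieDual K g) (t : g ⊗[K] g) :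
    ev2 ξ (c • η) t = c * ev2 ξ η t := by
  simp [ev2, TensorProduct.map_smul_right]

/-- The bracket of `g^*` contracted with the first slot of a tensor. -/
theorem ev1_lie (ξ η : LieDual K g) (t : g ⊗[K] g) :
    ev1 ⁅ξ, η⁆ t = ev12 ξ η (tensorId cobracket t) := by
  have key : ∀ (s : g ⊗[K] g) (b : g),
      ev12 ξ η (TensorProduct.assoc K g g g (s ⊗ₜ b)) = ev2 ξ η s • b := by
    intro s b
    induction s with
    | zero => simp
    | tmul a c => simp
    | add s t hs ht => rw [TensorProduct.add_tmul]; simp [hs, ht, add_smul]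
  induction t with
  | zero => simp
  | tmul a b => simp [tensorId, key, lie_apply]
  | add s t hs ht => simp [hs, ht]

theorem ev12_cyc (η ζ : LieDual K g) (s : g ⊗[K] g) (b : g) :
    ev12 η ζ (cyc K g (TensorProduct.assoc K g g g (s ⊗ₜ b))) =
      toDual ζ b • ev1 η (TensorProduct.comm K g g s) := by
  induction s with
  | zero => simp
  | tmul a c => simp [cyc_tmul, smul_smul, mul_comm]
  | add s t hs ht => rw [TensorProduct.add_tmul]; simp [hs, ht]

theorem ev12_cyc_cyc (η ζ : LieDual K g) (s : g ⊗[K] g) (b : g) :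
    ev12 η ζ (cyc K g (cyc K g (TensorProduct.assoc K g g g (s ⊗ₜ b)))) =
      toDual η b • ev1 ζ s := by
  induction s with
  | zero => simp
  | tmul a c => simp [cyc_tmul, smul_smul]
  | add s t hs ht => rw [TensorProduct.add_tmul]; simp [hs, ht]

theorem ev12_cyc_tensorId (η ζ : LieDual K g) (t : g ⊗[K] g) :
    ev12 η ζ (cyc K g (tensorId cobracket t)) =
      -ev1 η (cobracket (ev1 ζ (TensorProduct.comm K g g t))) := by
  induction t with
  | zero => simp
  | tmul a b => simp [tensorId, ev12_cyc, comm_cobracket]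
  | add s t hs ht => simp only [map_add, hs, ht]; abel

theorem ev12_cyc_cyc_tensorId (η ζ : LieDual K g) (t : g ⊗[K] g) :
    ev12 η ζ (cyc K g (cyc K g (tensorId cobracket t))) =
      ev1 ζ (cobracket (ev1 η (TensorProduct.comm K g g t))) := by
  induction t with
  | zero => simp
  | tmul a b => simp [tensorId, ev12_cyc_cyc]
  | add s t hs ht => simp only [map_add, hs, ht]

theorem coadG_lie_right (x : g) (η ζ : LieDual K g) :
    coadG x ⁅η, ζ⁆ = coadG (coadG x η) ζ - coadG (coadG x ζ) η := by
  have h := congrArg (ev12 η ζ) (coJacobi (K := K) x)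
  simp only [alt, LinearMap.add_apply, LinearMap.comp_apply, LinearMap.id_apply, map_add,
    map_zero, ev12_cyc_tensorId, ev12_cyc_cyc_tensorId, ← ev1_lie, comm_cobracket, map_neg,
    neg_neg] at h
  rw [← sub_eq_zero, ← h]
  simp only [coadG]
  abel

theorem ev1_lie_tensor (x : g) (ζ : LieDual K g) (t : g ⊗[K] g) :
    ev1 ζ ⁅x, t⁆ = ⁅x, ev1 ζ t⁆ - ev1 (coadD x ζ) t := by
  induction t with
  | zero => simp
  | tmul a b => simp [TensorProduct.LieModule.lie_tmul_right]; abel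
  | add s t hs ht => simp only [lie_add, map_add, hs, ht]; abel

theorem ev2_lie_tensor (x : g) (η ζ : LieDual K g) (t : g ⊗[K] g) :
    ev2 η ζ ⁅x, t⁆ = - ev2 (coadD x η) ζ t - ev2 η (coadD x ζ) t := by
  induction t with
  | zero => simp
  | tmul a b => simp [TensorProduct.LieModule.lie_tmul_right]
  | add s t hs ht => simp only [lie_add, map_add, hs, ht]; ring

theorem coadG_lie_left (x y : g) (ζ : LieDual K g) :
    coadG ⁅x, y⁆ ζ = ⁅x, coadG y ζ⁆ - ⁅y, coadG x ζ⁆ + coadG x (coadD y ζ)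
      - coadG y (coadD x ζ) := by
  simp only [coadG, cocycle, map_sub, ev1_lie_tensor]
  abel

theorem coadD_lie_left (x y : g) (ζ : LieDual K g) :
    coadD ⁅x, y⁆ ζ = coadD x (coadD y ζ) - coadD y (coadD x ζ) := by
  apply LieDual.ext
  intro z
  simp [lie_lie]

theorem coadD_lie_right (x : g) (η ζ : LieDual K g) :
    coadD x ⁅η, ζ⁆ = ⁅coadD x η, ζ⁆ + ⁅η, coadD x ζ⁆ + coadD (coadG x η) ζ
      - coadD (coadG x ζ) η := by
  apply LieDual.ext
  intro y
  have h1 : toDual ζ ⁅coadG x η, y⁆ = - ev2 η (toDual.symm (toDual ζ ∘ₗ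
      (LieAlgebra.ad K g y : g →ₗ[K] g))) (cobracket x) := by
    rw [← toDual_ev1, ← lie_skew, map_neg]; rfl
  have h2 : toDual η ⁅coadG x ζ, y⁆ = - ev2 ζ (toDual.symm (toDual η ∘ₗ
      (LieAlgebra.ad K g y : g →ₗ[K] g))) (cobracket x) := by
    rw [← toDual_ev1, ← lie_skew, map_neg]; rfl
  have e1 : (toDual.symm (toDual ζ ∘ₗ (LieAlgebra.ad K g y : g →ₗ[K] g))) = (-1 : K) • coadD y ζ := by
    apply LieDual.ext; intro z; simp
  have e2 : (toDual.symm (toDual η ∘ₗ (LieAlgebra.ad K g y : g →ₗ[K] g))) = (-1 : K) • coadD y η := by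
    apply LieDual.ext; intro z; simp
  rw [e1, ev2_smul_right] at h1
  rw [e2, ev2_smul_right, ev2_cobracket_swap] at h2
  simp only [map_add, map_sub, LinearMap.add_apply, LinearMap.sub_apply, coadD_apply,
    LieDual.lie_apply, cocycle, ev2_lie_tensor, h1, h2]
  ring

variable [CharZero K]

theorem LieDual.lie_self' (ξ : LieDual K g) : ⁅ξ, ξ⁆ = 0 := by
  apply LieDual.ext
  intro x
  have := ev2_cobracket_swap ξ ξ x
  rw [LieDual.lie_apply, map_zero, LinearMap.zero_apply]
  exact self_eq_neg.1 this

theorem LieDual.lie_skew' (ξ η : LieDual K g) : ⁅ξ, η⁆ = -⁅η, ξ⁆ := by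
  apply LieDual.ext
  intro x
  rw [map_neg, LinearMap.neg_apply, LieDual.lie_apply, LieDual.lie_apply, ev2_cobracket_swap]

/-- The Lie bracket on `g^*` dual to the cobracket of `g`. -/
instance : LieRing (LieDual K g) where
  add_lie ξ η ζ := by
    apply LieDual.ext; intro x; simp [LieDual.lie_apply, ev2_add_left]
  lie_add ξ η ζ := by
    apply LieDual.ext; intro x; simp [LieDual.lie_apply, ev2_add_right]
  lie_self := LieDual.lie_self'
  leibniz_lie ξ η ζ := by
    apply LieDual.ext
    intro x
    have h := congrArg (toDual ζ) (coadG_lie_right x ξ η)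
    simp only [coadG, toDual_ev1, map_sub, ← LieDual.lie_apply] at h
    simp only [map_add, LinearMap.add_apply, LieDual.lie_apply] at h ⊢
    rw [h]
    simp only [← LieDual.lie_apply]
    ring

instance : LieAlgebra K (LieDual K g) where
  lie_smul c ξ η := by
    apply LieDual.ext; intro x; simp [LieDual.lie_apply, ev2_smul_right]

namespace Double

/-- The projection `d(g) → g`. -/
def fst : Double K g →ₗ[K] g := LinearMap.fst K g (LieDual K g)

/-- The projection `d(g) → g^*`. -/
def snd : Double K g →ₗ[K] LieDual K g := LinearMap.snd K g (LieDual K g)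

/-- The inclusion `g → d(g)`. -/
def inl : g →ₗ[K] Double K g := LinearMap.inl K g (LieDual K g)

theorem ext {v w : Double K g} (h₁ : fst v = fst w) (h₂ : snd v = snd w) : v = w :=
  Prod.ext h₁ h₂

/-- The bracket of the Drinfeld double. It extends the brackets of `g` and of `g^*`, and its mixed
brackets are the ones for which the canonical bilinear form is invariant. -/
instance : Bracket (Double K g) (Double K g) where
  bracket v w := (⁅fst v, fst w⁆ + coadG (fst v) (snd w) - coadG (fst w) (snd v),
    ⁅snd v, snd w⁆ + coadD (fst v) (snd w) - coadD (fst w) (snd v))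

theorem fst_lie (v w : Double K g) : fst ⁅v, w⁆ =
    ⁅fst v, fst w⁆ + coadG (fst v) (snd w) - coadG (fst w) (snd v) := rfl

theorem snd_lie (v w : Double K g) : snd ⁅v, w⁆ =
    ⁅snd v, snd w⁆ + coadD (fst v) (snd w) - coadD (fst w) (snd v) := rfl

end Double

theorem coadG_add_left (x y : g) (ξ : LieDual K g) : coadG (x + y) ξ = coadG x ξ + coadG y ξ := by
  simp [coadG]

theorem coadG_add_right (x : g) (ξ η : LieDual K g) :
    coadG x (ξ + η) = coadG x ξ + coadG x η := by
  simp [coadG, ev1, LinearMap.rTensor_add]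

theorem coadG_smul_left (c : K) (x : g) (ξ : LieDual K g) : coadG (c • x) ξ = c • coadG x ξ := by
  simp [coadG]

theorem coadG_smul_right (c : K) (x : g) (ξ : LieDual K g) : coadG x (c • ξ) = c • coadG x ξ := by
  simp [coadG, ev1, LinearMap.rTensor_smul]

theorem coadD_add_left (x y : g) (ξ : LieDual K g) : coadD (x + y) ξ = coadD x ξ + coadD y ξ := by
  apply LieDual.ext; intro z; simp; ring

theorem coadD_add_right (x : g) (ξ η : LieDual K g) :
    coadD x (ξ + η) = coadD x ξ + coadD x η := by
  apply LieDual.ext; intro z; simp; ring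

theorem coadD_smul_left (c : K) (x : g) (ξ : LieDual K g) : coadD (c • x) ξ = c • coadD x ξ := by
  apply LieDual.ext; intro z; simp

theorem coadD_smul_right (c : K) (x : g) (ξ : LieDual K g) : coadD x (c • ξ) = c • coadD x ξ := by
  apply LieDual.ext; intro z; simp

theorem coadG_sub_left (x y : g) (ξ : LieDual K g) : coadG (x - y) ξ = coadG x ξ - coadG y ξ := by
  simp [coadG]

theorem coadG_sub_right (x : g) (ξ η : LieDual K g) :
    coadG x (ξ - η) = coadG x ξ - coadG x η := by
  simp [coadG, ev1, LinearMap.rTensor_sub]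

theorem coadD_sub_left (x y : g) (ξ : LieDual K g) : coadD (x - y) ξ = coadD x ξ - coadD y ξ := by
  apply LieDual.ext; intro z; simp; ring

theorem coadD_sub_right (x : g) (ξ η : LieDual K g) :
    coadD x (ξ - η) = coadD x ξ - coadD x η := by
  apply LieDual.ext; intro z; simp; ring

theorem Double.leibniz_fst (x y z : g) (ξ η ζ : LieDual K g) :
    ⁅x, ⁅y, z⁆ + coadG y ζ - coadG z η⁆ + coadG x (⁅η, ζ⁆ + coadD y ζ - coadD z η)
        - coadG (⁅y, z⁆ + coadG y ζ - coadG z η) ξ =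
      (⁅⁅x, y⁆ + coadG x η - coadG y ξ, z⁆ + coadG (⁅x, y⁆ + coadG x η - coadG y ξ) ζ
        - coadG z (⁅ξ, η⁆ + coadD x η - coadD y ξ)) +
      (⁅y, ⁅x, z⁆ + coadG x ζ - coadG z ξ⁆ + coadG y (⁅ξ, ζ⁆ + coadD x ζ - coadD z ξ)
        - coadG (⁅x, z⁆ + coadG x ζ - coadG z ξ) η) := by
  simp only [lie_add, add_lie, lie_sub, sub_lie, coadG_add_left, coadG_add_right, coadG_sub_left,
    coadG_sub_right, coadG_lie_left, coadG_lie_right]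
  rw [leibniz_lie x y z, ← lie_skew (coadG x η) z, ← lie_skew (coadG y ξ) z]
  abel

theorem Double.leibniz_snd (x y z : g) (ξ η ζ : LieDual K g) :
    ⁅ξ, ⁅η, ζ⁆ + coadD y ζ - coadD z η⁆ + coadD x (⁅η, ζ⁆ + coadD y ζ - coadD z η)
        - coadD (⁅y, z⁆ + coadG y ζ - coadG z η) ξ =
      (⁅⁅ξ, η⁆ + coadD x η - coadD y ξ, ζ⁆ + coadD (⁅x, y⁆ + coadG x η - coadG y ξ) ζ
        - coadD z (⁅ξ, η⁆ + coadD x η - coadD y ξ)) +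
      (⁅η, ⁅ξ, ζ⁆ + coadD x ζ - coadD z ξ⁆ + coadD y (⁅ξ, ζ⁆ + coadD x ζ - coadD z ξ)
        - coadD (⁅x, z⁆ + coadG x ζ - coadG z ξ) η) := by
  simp only [lie_add, add_lie, lie_sub, sub_lie, coadD_add_left, coadD_add_right, coadD_sub_left,
    coadD_sub_right, coadD_lie_left, coadD_lie_right]
  rw [leibniz_lie ξ η ζ, ← lie_skew (coadD z ξ) η]
  abel

/-- The Drinfeld double is a Lie algebra. -/
instance : LieRing (Double K g) where
  add_lie u v w := by
    apply Double.ext <;> simp only [Double.fst_lie, Double.snd_lie, map_add, add_lie,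
      coadG_add_left, coadG_add_right, coadD_add_left, coadD_add_right] <;> abel
  lie_add u v w := by
    apply Double.ext <;> simp only [Double.fst_lie, Double.snd_lie, map_add, lie_add,
      coadG_add_left, coadG_add_right, coadD_add_left, coadD_add_right] <;> abel
  lie_self v := by
    apply Double.ext <;> simp [Double.fst_lie, Double.snd_lie]
  leibniz_lie u v w := Double.ext
    (Double.leibniz_fst (Double.fst u) (Double.fst v) (Double.fst w)
      (Double.snd u) (Double.snd v) (Double.snd w))
    (Double.leibniz_snd (Double.fst u) (Double.fst v) (Double.fst w)
      (Double.snd u) (Double.snd v) (Double.snd w))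

instance : LieAlgebra K (Double K g) where
  lie_smul c v w := by
    apply Double.ext <;> simp only [Double.fst_lie, Double.snd_lie, map_smul, lie_smul,
      coadG_smul_left, coadG_smul_right, coadD_smul_left, coadD_smul_right, smul_add, smul_sub]

/-- The inclusion of Lie algebras `g^* → d(g)`. -/
def Double.inr : LieDual K g →ₗ⁅K⁆ Double K g :=
  { LinearMap.inr K g (LieDual K g) with
    map_lie' := by
      intro ξ η
      apply Double.ext
      · change (0 : g) = ⁅(0 : g), (0 : g)⁆ + coadG 0 η - coadG 0 ξ
        simp [coadG]
      · change ⁅ξ, η⁆ = ⁅ξ, η⁆ + coadD 0 η - coadD 0 ξ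
        have h : ∀ ζ : LieDual K g, coadD 0 ζ = 0 := fun ζ => by
          apply LieDual.ext; intro z; simp
        simp [h] }

end Double

/-! ### The function algebra of a formal group -/

section FormalGroup

variable (K a : Type*) [Field K] [LieRing a] [LieAlgebra K a]

/-- The universal enveloping algebra `U(a)`. -/
abbrev U : Type _ := UniversalEnvelopingAlgebra K a

attribute [local instance] LieRing.ofAssociativeRing

variable {K a} in
theorem U.hom_ext {A : Type*} [Ring A] [Algebra K A] {f h : U K a →ₐ[K] A}
    (H : ∀ x, f (UniversalEnvelopingAlgebra.ι K x) = h (UniversalEnvelopingAlgebra.ι K x)) :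
    f = h :=
  UniversalEnvelopingAlgebra.hom_ext K (LieHom.ext H)

/-- The coproduct of `U(a)`, with `x ↦ x ⊗ 1 + 1 ⊗ x` for `x ∈ a`. -/
def U.comul : U K a →ₐ[K] U K a ⊗[K] U K a :=
  UniversalEnvelopingAlgebra.lift K
    { toFun := fun x => UniversalEnvelopingAlgebra.ι K x ⊗ₜ[K] (1 : U K a) +
        (1 : U K a) ⊗ₜ[K] UniversalEnvelopingAlgebra.ι K x
      map_add' := fun x y => by
        simp only [map_add, TensorProduct.add_tmul, TensorProduct.tmul_add]; abel
      map_smul' := fun c x => by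
        simp only [map_smul, TensorProduct.smul_tmul', TensorProduct.tmul_smul, smul_add,
          RingHom.id_apply]
      map_lie' := fun {x y} => by
        simp only [LieHom.map_lie, LieRing.of_associative_ring_bracket, mul_add, add_mul,
          Algebra.TensorProduct.tmul_mul_tmul, mul_one, one_mul, TensorProduct.sub_tmul,
          TensorProduct.tmul_sub]
        abel }

/-- The counit of `U(a)`, with `x ↦ 0` for `x ∈ a`. -/
def U.counit : U K a →ₐ[K] K := UniversalEnvelopingAlgebra.lift K 0

variable {K a} in
@[simp] theorem U.comul_ι (x : a) : U.comul K a (UniversalEnvelopingAlgebra.ι K x) =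
    UniversalEnvelopingAlgebra.ι K x ⊗ₜ[K] (1 : U K a) +
        (1 : U K a) ⊗ₜ[K] UniversalEnvelopingAlgebra.ι K x :=
  UniversalEnvelopingAlgebra.lift_ι_apply K _ x

variable {K a} in
@[simp] theorem U.counit_ι (x : a) : U.counit K a (UniversalEnvelopingAlgebra.ι K x) = 0 :=
  UniversalEnvelopingAlgebra.lift_ι_apply K _ x

instance : Bialgebra K (U K a) :=
  Bialgebra.ofAlgHom (U.comul K a) (U.counit K a)
    (U.hom_ext fun x => by
      simp only [AlgHom.comp_apply, U.comul_ι, map_add, Algebra.TensorProduct.map_tmul, map_one,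
        AlgHom.id_apply, TensorProduct.add_tmul, TensorProduct.tmul_add,
        Algebra.TensorProduct.one_def]
      simp [add_assoc, -UniversalEnvelopingAlgebra.ι_apply])
    (U.hom_ext fun x => by simp [-UniversalEnvelopingAlgebra.ι_apply])
    (U.hom_ext fun x => by simp [-UniversalEnvelopingAlgebra.ι_apply])

theorem U.comul_eq (X : U K a) : Coalgebra.comul (R := K) X = U.comul K a X := rfl

instance : Coalgebra.IsCocomm K (U K a) where
  comm_comp_comul := by
    have : (Algebra.TensorProduct.comm K (U K a) (U K a)).toAlgHom.comp (U.comul K a) =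
        U.comul K a := U.hom_ext fun x => by simp [add_comm, -UniversalEnvelopingAlgebra.ι_apply]
    exact congrArg AlgHom.toLinearMap this

/-- The antipode of `U(a)`, as an algebra morphism to the opposite algebra; `x ↦ -x` for
`x ∈ a`. -/
def U.antipode : U K a →ₐ[K] (U K a)ᵐᵒᵖ :=
  UniversalEnvelopingAlgebra.lift K
    { toFun := fun x => -MulOpposite.op (UniversalEnvelopingAlgebra.ι K x)
      map_add' := fun x y => by simp only [map_add, MulOpposite.op_add]; abel
      map_smul' := fun c x => by simp
      map_lie' := fun {x y} => by
        simp only [LieHom.map_lie, LieRing.of_associative_ring_bracket, MulOpposite.op_sub,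
          MulOpposite.op_mul, neg_mul_neg, neg_sub] }

/-- The function algebra `K[[A]] = U(a)^*` of the formal group `A` with Lie algebra `a`: the full
linear dual of `U(a)`, with the (commutative) product dual to the coproduct of `U(a)`. -/
abbrev FormalFun : Type _ := WithConv (U K a →ₗ[K] K)

variable {K a}

theorem FormalFun.mul_apply (f h : FormalFun K a) (X : U K a) :
    (f * h).ofConv X = LinearMap.mul' K K (TensorProduct.map f.ofConv h.ofConv (U.comul K a X)) :=
  rfl

/-- The infinitesimal right translation `(R_x f)(y) = d/dε f(y e^{εx})`: in terms of functionals
on `U(a)`, `(R_x f)(X) = f(X x)`. -/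
def rightTrans (x : a) : Derivation K (FormalFun K a) (FormalFun K a) :=
  Derivation.mk'
    { toFun := fun f => WithConv.toConv
        (f.ofConv ∘ₗ LinearMap.mulRight K (UniversalEnvelopingAlgebra.ι K x))
      map_add' := fun f h => rfl
      map_smul' := fun c f => rfl }
    (fun f h => by
      have key : ∀ t : U K a ⊗[K] U K a,
          LinearMap.mul' K K (TensorProduct.map f.ofConv h.ofConv
            (t * U.comul K a (UniversalEnvelopingAlgebra.ι K x))) =
          LinearMap.mul' K K (TensorProduct.map f.ofConv
            (h.ofConv ∘ₗ LinearMap.mulRight K (UniversalEnvelopingAlgebra.ι K x)) t) +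
          LinearMap.mul' K K (TensorProduct.map
            (f.ofConv ∘ₗ LinearMap.mulRight K (UniversalEnvelopingAlgebra.ι K x)) h.ofConv t) := by
        intro t
        induction t with
        | zero => simp
        | tmul y z =>
          simp only [U.comul_ι, mul_add, Algebra.TensorProduct.tmul_mul_tmul, mul_one, map_add,
            TensorProduct.map_tmul, LinearMap.mul'_apply, LinearMap.comp_apply,
            LinearMap.mulRight_apply]
          ring
        | add s t hs ht => rw [add_mul, map_add, map_add, hs, ht]; simp only [map_add]; ring
      have h2 := fun X => key (U.comul K a X)
      simp only [← map_mul] at h2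
      rw [smul_eq_mul, smul_eq_mul, mul_comm h]
      exact WithConv.ofConv_injective (LinearMap.ext h2))

/-- The infinitesimal left translation `(L_x f)(y) = d/dε f(e^{-εx} y)`: in terms of functionals
on `U(a)`, `(L_x f)(X) = -f(x X)`. -/
def leftTrans (x : a) : Derivation K (FormalFun K a) (FormalFun K a) :=
  Derivation.mk'
    { toFun := fun f => WithConv.toConv
        (-(f.ofConv ∘ₗ LinearMap.mulLeft K (UniversalEnvelopingAlgebra.ι K x)))
      map_add' := fun f h => by ext X; simp; ring
      map_smul' := fun c f => by ext X; simp }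
    (fun f h => by
      have key : ∀ t : U K a ⊗[K] U K a,
          -LinearMap.mul' K K (TensorProduct.map f.ofConv h.ofConv
            (U.comul K a (UniversalEnvelopingAlgebra.ι K x) * t)) =
          LinearMap.mul' K K (TensorProduct.map f.ofConv
            (-(h.ofConv ∘ₗ LinearMap.mulLeft K (UniversalEnvelopingAlgebra.ι K x))) t) +
          LinearMap.mul' K K (TensorProduct.map
            (-(f.ofConv ∘ₗ LinearMap.mulLeft K (UniversalEnvelopingAlgebra.ι K x)))
            h.ofConv t) := by
        intro t
        induction t with
        | zero => simp
        | tmul y z =>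
          simp only [U.comul_ι, add_mul, Algebra.TensorProduct.tmul_mul_tmul, one_mul, map_add,
            TensorProduct.map_tmul, LinearMap.mul'_apply, LinearMap.comp_apply,
            LinearMap.mulLeft_apply, LinearMap.neg_apply]
          ring
        | add s t hs ht => rw [mul_add, map_add, map_add, neg_add, hs, ht]; simp only [map_add]; ring
      have h2 := fun X => key (U.comul K a X)
      simp only [← map_mul] at h2
      rw [smul_eq_mul, smul_eq_mul, mul_comm h]
      exact WithConv.ofConv_injective (LinearMap.ext h2))

/-- For a Lie algebra morphism `φ : a → b`, the adjoint action `Ad(x⁻¹)` on `b` of the generic point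
`x` of the formal group of `a`: an `End(b)`-valued functional on `U(a)`, `X ↦ ad(S(X))` where `S` is
the antipode. -/
def adInv {b : Type*} [LieRing b] [LieAlgebra K b] (φ : a →ₗ⁅K⁆ b) : U K a →ₗ[K] Module.End K b :=
  (UniversalEnvelopingAlgebra.lift K ((LieAlgebra.ad K b).comp φ)).toLinearMap ∘ₗ
    (MulOpposite.opLinearEquiv K).symm.toLinearMap ∘ₗ (U.antipode K a).toLinearMap

end FormalGroup

/-! ### Extension of derivations to localizations -/

section Localization

variable {K O : Type*} [Field K] [CommRing O] [Algebra K O]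

/-- The algebra morphism `f ↦ f + ε D(f)` from `O` to the dual numbers over `O[1/P]`. -/
def derDual (D : Derivation K O O) (P : O) :
    O →+* TrivSqZeroExt (Localization.Away P) (Localization.Away P) where
  toFun f := TrivSqZeroExt.inl (algebraMap O _ f) + TrivSqZeroExt.inr (algebraMap O _ (D f))
  map_one' := by ext <;> simp
  map_zero' := by ext <;> simp
  map_add' f h := by ext <;> simp [Algebra.smul_def]
  map_mul' f h := by
    ext
    · simp
    · simp only [Derivation.leibniz, smul_eq_mul, map_add, map_mul, TrivSqZeroExt.snd_add,
        TrivSqZeroExt.snd_inl, TrivSqZeroExt.snd_inr, TrivSqZeroExt.snd_mul,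
        TrivSqZeroExt.fst_add, TrivSqZeroExt.fst_inl, TrivSqZeroExt.fst_inr, zero_add, add_zero,
        op_smul_eq_smul]

/-- The extension of `derDual` to `O[1/P]`. -/
def derDualLoc (D : Derivation K O O) (P : O) :
    Localization.Away P →+* TrivSqZeroExt (Localization.Away P) (Localization.Away P) :=
  IsLocalization.Away.lift P (g := derDual D P)
    (TrivSqZeroExt.isUnit_iff_isUnit_fst.2 (by
      simpa [derDual] using IsLocalization.Away.algebraMap_isUnit (S := Localization.Away P) P))

theorem derDualLoc_algebraMap (D : Derivation K O O) (P f : O) :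
    derDualLoc D P (algebraMap O _ f) = derDual D P f :=
  IsLocalization.Away.lift_eq P _ f

theorem fst_derDualLoc (D : Derivation K O O) (P : O) (f : Localization.Away P) :
    (derDualLoc D P f).fst = f := by
  have : ((TrivSqZeroExt.fstHom (Localization.Away P) (Localization.Away P)
      (Localization.Away P)).toRingHom.comp (derDualLoc D P)) = RingHom.id _ := by
    apply IsLocalization.ringHom_ext (Submonoid.powers P)
    ext f
    simp [derDualLoc_algebraMap, derDual]
  exact congrArg (fun φ : Localization.Away P →+* Localization.Away P => φ f) this

/-- The extension of a derivation of `O` to the localization `O[1/P]`. It is the unique derivation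
which agrees with `D` on `O`. -/
def extendDer (D : Derivation K O O) (P : O) :
    Derivation K (Localization.Away P) (Localization.Away P) :=
  Derivation.mk'
    { toFun := fun f => (derDualLoc D P f).snd
      map_add' := fun f h => by simp
      map_smul' := fun c f => by
        have hc : derDualLoc D P (algebraMap K _ c) =
            TrivSqZeroExt.inl (algebraMap K _ c) := by
          rw [IsScalarTower.algebraMap_apply K O (Localization.Away P), derDualLoc_algebraMap]
          ext <;> simp [derDual]
        rw [Algebra.smul_def, map_mul, hc]
        simp [Algebra.smul_def] }
    (fun f h => by simp [fst_derDualLoc, mul_comm])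

theorem extendDer_algebraMap (D : Derivation K O O) (P f : O) :
    extendDer D P (algebraMap O _ f) = algebraMap O _ (D f) := by
  change (derDualLoc D P (algebraMap O _ f)).snd = _
  rw [derDualLoc_algebraMap]
  simp only [derDual, RingHom.coe_mk, MonoidHom.coe_mk, OneHom.coe_mk, TrivSqZeroExt.snd_add,
    TrivSqZeroExt.snd_inl, TrivSqZeroExt.snd_inr, zero_add]

end Localization

open LieBialgebra LieDual

/-! ### Lie subbialgebras -/

section Sub

/-- A Lie subbialgebra of `g`: a Lie subalgebra `h` with `δ(h) ⊆ h ⊗ h`. -/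
structure LieSubbialgebra (K g : Type*) [Field K] [LieRing g] [LieAlgebra K g] [LieBialgebra K g]
    extends LieSubalgebra K g where
  cobracket_mem' : ∀ x ∈ carrier, LieBialgebra.cobracket (K := K) x ∈
    LinearMap.range (TensorProduct.mapIncl toLieSubalgebra.toSubmodule toLieSubalgebra.toSubmodule)

variable {K g : Type*} [Field K] [LieRing g] [LieAlgebra K g] [LieBialgebra K g]
  (h : LieSubbialgebra K g)

/-- The inclusion `h ⊗ h → g ⊗ g`. -/
def LieSubbialgebra.incl2 :
    h.toLieSubalgebra ⊗[K] h.toLieSubalgebra →ₗ[K] g ⊗[K] g :=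
  TensorProduct.map h.toLieSubalgebra.toSubmodule.subtype h.toLieSubalgebra.toSubmodule.subtype

theorem LieSubbialgebra.incl2_injective : Function.Injective h.incl2 :=
  TensorProduct.map_injective_of_flat_flat _ _
    (Submodule.subtype_injective _) (Submodule.subtype_injective _)

/-- The cobracket of `g`, restricted to a map `h → h ⊗ h`. -/
def LieSubbialgebra.cobr :
    h.toLieSubalgebra →ₗ[K] h.toLieSubalgebra ⊗[K] h.toLieSubalgebra :=
  (LinearEquiv.ofInjective h.incl2 h.incl2_injective).symm.toLinearMap ∘ₗ
    LinearMap.codRestrict (LinearMap.range h.incl2)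
      (cobracket (K := K) ∘ₗ h.toLieSubalgebra.toSubmodule.subtype)
      (fun x => h.cobracket_mem' x.1 x.2)

theorem LieSubbialgebra.incl2_cobr (x : h.toLieSubalgebra) :
    h.incl2 (h.cobr x) = cobracket (K := K) (x : g) := by
  have := LinearEquiv.apply_symm_apply (LinearEquiv.ofInjective h.incl2 h.incl2_injective)
    (LinearMap.codRestrict (LinearMap.range h.incl2)
      (cobracket (K := K) ∘ₗ h.toLieSubalgebra.toSubmodule.subtype)
      (fun x => h.cobracket_mem' x.1 x.2) x)
  exact congrArg Subtype.val this

/-- The inclusion `h ⊗ h ⊗ h → g ⊗ g ⊗ g`. -/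
def LieSubbialgebra.incl3 :
    h.toLieSubalgebra ⊗[K] (h.toLieSubalgebra ⊗[K] h.toLieSubalgebra) →ₗ[K]
      g ⊗[K] (g ⊗[K] g) :=
  TensorProduct.map h.toLieSubalgebra.toSubmodule.subtype h.incl2

theorem LieSubbialgebra.incl3_injective : Function.Injective h.incl3 :=
  TensorProduct.map_injective_of_flat_flat _ _ (Submodule.subtype_injective _) h.incl2_injective

theorem LieSubbialgebra.incl2_comm (t : h.toLieSubalgebra ⊗[K] h.toLieSubalgebra) :
    h.incl2 (TensorProduct.comm K _ _ t) = TensorProduct.comm K _ _ (h.incl2 t) := by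
  induction t with
  | zero => simp
  | tmul a b => rfl
  | add s t hs ht => simp only [map_add, hs, ht]

theorem LieSubbialgebra.incl3_cyc
    (t : h.toLieSubalgebra ⊗[K] (h.toLieSubalgebra ⊗[K] h.toLieSubalgebra)) :
    h.incl3 (cyc K _ t) = cyc K _ (h.incl3 t) := by
  induction t with
  | zero => simp
  | tmul a s =>
    induction s with
    | zero => simp
    | tmul b c => rfl
    | add s t hs ht => simp only [TensorProduct.tmul_add, map_add, hs, ht]
  | add s t hs ht => simp only [map_add, hs, ht]

theorem LieSubbialgebra.incl3_assoc (s : h.toLieSubalgebra ⊗[K] h.toLieSubalgebra)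
    (b : h.toLieSubalgebra) :
    h.incl3 (TensorProduct.assoc K _ _ _ (s ⊗ₜ b)) =
      TensorProduct.assoc K g g g (h.incl2 s ⊗ₜ (b : g)) := by
  induction s with
  | zero => simp
  | tmul a c => rfl
  | add s t hs ht => simp only [TensorProduct.add_tmul, map_add, hs, ht]

theorem LieSubbialgebra.incl3_tensorId (t : h.toLieSubalgebra ⊗[K] h.toLieSubalgebra) :
    h.incl3 (tensorId h.cobr t) = tensorId (cobracket (K := K)) (h.incl2 t) := by
  induction t with
  | zero => simp
  | tmul a b =>
    change h.incl3 (TensorProduct.assoc K _ _ _ (h.cobr a ⊗ₜ b)) = _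
    rw [h.incl3_assoc, h.incl2_cobr]
    rfl
  | add s t hs ht => simp only [map_add, hs, ht]

theorem LieSubbialgebra.incl2_lie (x : h.toLieSubalgebra)
    (t : h.toLieSubalgebra ⊗[K] h.toLieSubalgebra) :
    h.incl2 ⁅x, t⁆ = ⁅(x : g), h.incl2 t⁆ := by
  induction t with
  | zero => simp
  | tmul a b =>
    rw [TensorProduct.LieModule.lie_tmul_right]
    change _ = ⁅(x : g), (a : g) ⊗ₜ[K] (b : g)⁆
    rw [TensorProduct.LieModule.lie_tmul_right, map_add]
    rfl
  | add s t hs ht => simp only [map_add, lie_add, hs, ht]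

/-- A Lie subbialgebra is a Lie bialgebra for the restricted cobracket. -/
instance : LieBialgebra K h.toLieSubalgebra where
  cobracket := h.cobr
  antisymm x := by
    rw [mem_wedge2]
    apply h.incl2_injective
    rw [h.incl2_comm, h.incl2_cobr, comm_cobracket, map_neg, h.incl2_cobr]
  coJacobi x := by
    apply h.incl3_injective
    have := coJacobi (K := K) (x : g)
    simp only [alt, LinearMap.add_apply, LinearMap.comp_apply, LinearMap.id_apply] at this ⊢
    simp only [map_add, h.incl3_cyc, h.incl3_tensorId, h.incl2_cobr, map_zero, this]
  cocycle x y := by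
    apply h.incl2_injective
    rw [map_sub, h.incl2_lie, h.incl2_lie, h.incl2_cobr, h.incl2_cobr, h.incl2_cobr]
    exact cocycle (x : g) (y : g)

end Sub

/-! ### Dressing action -/

section Dressing

variable (K h : Type*) [Field K] [CharZero K] [LieRing h] [LieAlgebra K h] [LieBialgebra K h]
  [FiniteDimensional K h]

/-- A basis `(e_i)` of `h`. -/
abbrev stdBasis : Module.Basis (Fin (Module.finrank K h)) K h := Module.finBasis K h

/-- The basis `(ε^i)` of `h^*` dual to `(e_i)`. -/
def dualVec (i : Fin (Module.finrank K h)) : LieDual K h := toDual.symm ((stdBasis K h).coord i)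

variable {K h}

/-- The left dressing action of `a ∈ h` on the function algebra of the formal group `H^*`,
`(dress^L_a f)(x) = -(R_{(Ad(x⁻¹)(a))_{h^*}} f)(x)`. Here `Ad` is the adjoint action of `H^*` on the
double `h ⊕ h^*`, and the component of `Ad(x⁻¹)(a)` in `h^*` is expanded as
`∑ i, ⟨Ad(x⁻¹)(a), e_i⟩ ε^i`. -/
def dressL (a : h) :
    Derivation K (FormalFun K (LieDual K h)) (FormalFun K (LieDual K h)) :=
  -∑ i, (WithConv.toConv
      (LinearMap.applyₗ (stdBasis K h i) ∘ₗ (toDual (K := K) (g := h)).toLinearMap ∘ₗ Double.snd ∘ₗ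
        LinearMap.applyₗ (Double.inl a) ∘ₗ adInv (Double.inr (K := K) (g := h))) :
      FormalFun K (LieDual K h)) • rightTrans (dualVec K h i)

end Dressing

/-! ### Poisson-Lie dynamical r-matrices -/

section RMatrix

variable (K g A : Type*) [Field K] [LieRing g] [LieAlgebra K g] [CommRing A] [Algebra K A]

/-- `(a ⊗ b, a' ⊗ b') ↦ [a, a'] ⊗ b ⊗ b'`. -/
def br12_13 : g ⊗[K] g →ₗ[K] g ⊗[K] g →ₗ[K] g ⊗[K] (g ⊗[K] g) :=
  TensorProduct.map₂ (LieModule.toEnd K g g : g →ₗ[K] Module.End K g) (TensorProduct.mk K g g)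

/-- `(a ⊗ b, a' ⊗ b') ↦ a ⊗ [b, a'] ⊗ b'`. -/
def br12_23 : g ⊗[K] g →ₗ[K] g ⊗[K] g →ₗ[K] g ⊗[K] (g ⊗[K] g) :=
  ((br12_13 K g).comp (TensorProduct.comm K g g).toLinearMap).compr₂
    (TensorProduct.leftComm K g g g).toLinearMap

/-- `(a ⊗ b, a' ⊗ b') ↦ a ⊗ a' ⊗ [b, b']`. -/
def br13_23 : g ⊗[K] g →ₗ[K] g ⊗[K] g →ₗ[K] g ⊗[K] (g ⊗[K] g) :=
  ((br12_13 K g).compl₁₂ (TensorProduct.comm K g g).toLinearMap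
    (TensorProduct.comm K g g).toLinearMap).compr₂ (cyc K g)

theorem br12_13_tmul (a b a' b' : g) :
    br12_13 K g (a ⊗ₜ b) (a' ⊗ₜ b') = ⁅a, a'⁆ ⊗ₜ (b ⊗ₜ b') := rfl

theorem br12_23_tmul (a b a' b' : g) :
    br12_23 K g (a ⊗ₜ b) (a' ⊗ₜ b') = a ⊗ₜ (⁅b, a'⁆ ⊗ₜ b') := rfl

theorem br13_23_tmul (a b a' b' : g) :
    br13_23 K g (a ⊗ₜ b) (a' ⊗ₜ b') = a ⊗ₜ (a' ⊗ₜ ⁅b, b'⁆) := rfl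

variable {K g A}

/-- `CYB(ρ) = [ρ^{1,2}, ρ^{1,3}] + [ρ^{1,2}, ρ^{2,3}] + [ρ^{1,3}, ρ^{2,3}]` for `ρ` with coefficients
in the commutative algebra `A`. -/
def CYB (ρ : (g ⊗[K] g) ⊗[K] A) : (g ⊗[K] (g ⊗[K] g)) ⊗[K] A :=
  TensorProduct.map₂ (br12_13 K g + br12_23 K g + br13_23 K g) (LinearMap.mul K A) ρ ρ

variable [CharZero K] [LieBialgebra K g] [FiniteDimensional K g] (h : LieSubbialgebra K g)

/-- The function algebra `K[[H^*]]` of the formal group of the Lie algebra `h^*` dual to a Lie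
subbialgebra `h`. -/
abbrev DualFun : Type _ := FormalFun K (LieDual K h.toLieSubalgebra)

variable {h} (P : DualFun h)

/-- `d^L(a ⊗ b ⊗ ℓ) = -∑ i, a ⊗ b ⊗ e_i ⊗ L_{ε^i}(ℓ)`, where `(e_i)` and `(ε^i)` are dual bases of `h`
and `h^*`. -/
def dL : (g ⊗[K] g) ⊗[K] Localization.Away P →ₗ[K]
    (g ⊗[K] (g ⊗[K] g)) ⊗[K] Localization.Away P :=
  -∑ i, TensorProduct.map
    ((TensorProduct.assoc K g g g).toLinearMap ∘ₗ
      (TensorProduct.mk K (g ⊗[K] g) g).flip (stdBasis K h.toLieSubalgebra i : g))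
    (extendDer (leftTrans (dualVec K h.toLieSubalgebra i)) P :
      Localization.Away P →ₗ[K] Localization.Away P)

variable (h)

/-- `ρ` is a Poisson-Lie dynamical r-matrix for `(H^*, g, Z)` with coefficients in `K[[H^*]][1/P]`.
(`Z` is meant to be a `g`-invariant antisymmetric tensor with `Alt((δ ⊗ id ⊗ id)(Z)) = 0`, such as
`Z = 0`.) -/
structure IsPLDynamicalRMatrix (Z : g ⊗[K] (g ⊗[K] g)) (P : DualFun h)
    (ρ : (g ⊗[K] g) ⊗[K] Localization.Away P) : Prop where
  ne_zero : P ≠ 0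
  /-- `ρ ∈ ∧²(g) ⊗ K[[H^*]][1/P]` -/
  mem_wedge2 : ρ ∈ LinearMap.range
    (LinearMap.rTensor (Localization.Away P) (wedge2 K g).subtype)
  /-- `dress^L_a(ρ) + [a ⊗ 1 + 1 ⊗ a, ρ] = 0` for `a ∈ h` -/
  equivariant : ∀ a : h.toLieSubalgebra,
    LinearMap.lTensor (g ⊗[K] g) (extendDer (dressL a) P :
        Localization.Away P →ₗ[K] Localization.Away P) ρ +
      LinearMap.rTensor (Localization.Away P) (LieModule.toEnd K g (g ⊗[K] g) (a : g)) ρ = 0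
  /-- `CYB(ρ) + Alt(d^L ρ) + Alt((δ ⊗ id)(ρ)) = Z` -/
  cdybe : CYB ρ + LinearMap.rTensor (Localization.Away P) (alt K g) (dL P ρ) +
    LinearMap.rTensor (Localization.Away P) (alt K g ∘ₗ tensorId (cobracket (K := K))) ρ = Z ⊗ₜ 1

end RMatrix

/-! ### Lie bialgebras with a splitting -/

section Splitting

variable {K g : Type*} [Field K] [LieRing g] [LieAlgebra K g] [LieBialgebra K g]

/-- `(g, δ, l, u)` is a Lie bialgebra with a splitting: `g = l ⊕ u`, `[l, u] ⊆ u` and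
`δ(u) ⊆ (l ⊗ u) ⊕ (u ⊗ l) ⊕ (u ⊗ u)`. -/
structure IsSplitting (l : LieSubbialgebra K g) (u : Submodule K g) : Prop where
  isCompl : IsCompl l.toLieSubalgebra.toSubmodule u
  lie_mem : ∀ x ∈ l.toLieSubalgebra, ∀ y ∈ u, ⁅x, y⁆ ∈ u
  cobracket_mem : ∀ y ∈ u, cobracket (K := K) y ∈
    LinearMap.range (TensorProduct.mapIncl l.toLieSubalgebra.toSubmodule u) ⊔
    LinearMap.range (TensorProduct.mapIncl u l.toLieSubalgebra.toSubmodule) ⊔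
    LinearMap.range (TensorProduct.mapIncl u u)

namespace IsSplitting

variable {l : LieSubbialgebra K g} {u : Submodule K g} (s : IsSplitting l u)

/-- The projection `g → l` parallel to `u`. -/
def projL : g →ₗ[K] l.toLieSubalgebra :=
  Submodule.projectionOnto l.toLieSubalgebra.toSubmodule u s.isCompl

theorem projL_of_mem_u {y : g} (hy : y ∈ u) : s.projL y = 0 :=
  (Submodule.projectionOnto_apply_eq_zero_iff s.isCompl).2 hy

theorem projL_coe (x : l.toLieSubalgebra) : s.projL (x : g) = x :=
  Submodule.projectionOnto_apply_left s.isCompl x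

/-- The pairing `ω₀(λ) : (u, v) ↦ λ([u, v]_l)` on `u`, for `λ ∈ l^*`. -/
def omega0 (lam : Module.Dual K l.toLieSubalgebra) : LinearMap.BilinForm K u :=
  ((LieModule.toEnd K g g : g →ₗ[K] Module.End K g).compl₁₂ u.subtype u.subtype).compr₂
    (lam ∘ₗ s.projL)

/-- Nondegeneracy of the splitting: `ω₀(λ)` is nondegenerate for generic `λ`. As the condition
`det ω₀(λ) ≠ 0` is Zariski open in `λ`, this means that some `ω₀(λ)` is nondegenerate. -/
def Nondegenerate : Prop := ∃ lam, (s.omega0 lam).Nondegenerate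

/-- The extension by zero on `u` of the functional `λ ∈ l^*`. -/
def extendDual : LieDual K l.toLieSubalgebra →ₗ[K] LieDual K g :=
  (toDual (K := K) (g := g)).symm.toLinearMap ∘ₗ LinearMap.lcomp K K s.projL ∘ₗ
    (toDual (K := K) (g := l.toLieSubalgebra)).toLinearMap

theorem extendDual_apply (lam : LieDual K l.toLieSubalgebra) (x : g) :
    toDual (s.extendDual lam) x = toDual lam (s.projL x) := rfl

theorem ev2_extendDual (lam mu : LieDual K l.toLieSubalgebra) (t : g ⊗[K] g) :
    ev2 (s.extendDual lam) (s.extendDual mu) t =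
      ev2 lam mu (TensorProduct.map s.projL s.projL t) := by
  induction t with
  | zero => simp
  | tmul a b => rfl
  | add x y hx hy => simp only [map_add, hx, hy]

theorem map_projL_incl2 (t : l.toLieSubalgebra ⊗[K] l.toLieSubalgebra) :
    TensorProduct.map s.projL s.projL (l.incl2 t) = t := by
  induction t with
  | zero => simp
  | tmul a b =>
    change s.projL (a : g) ⊗ₜ[K] s.projL (b : g) = _
    rw [projL_coe, projL_coe]
  | add x y hx hy => simp only [map_add, hx, hy]

theorem map_projL_cobracket_of_mem {y : g} (hy : y ∈ u) :
    TensorProduct.map s.projL s.projL (cobracket (K := K) y) = 0 := by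
  have h0 : s.projL ∘ₗ u.subtype = 0 := LinearMap.ext fun z => s.projL_of_mem_u z.2
  have hle : LinearMap.range (TensorProduct.mapIncl l.toLieSubalgebra.toSubmodule u) ⊔
      LinearMap.range (TensorProduct.mapIncl u l.toLieSubalgebra.toSubmodule) ⊔
      LinearMap.range (TensorProduct.mapIncl u u) ≤
      LinearMap.ker (TensorProduct.map s.projL s.projL) := by
    refine sup_le (sup_le ?_ ?_) ?_ <;>
    · rw [LinearMap.range_le_ker_iff, TensorProduct.mapIncl, ← TensorProduct.map_comp, h0]
      simp
  exact hle (s.cobracket_mem y hy)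

variable [CharZero K]

/-- The inclusion of Lie algebras `l^* → g^*` defined by the splitting (extension of functionals by
zero on `u`). -/
def dualIncl : LieDual K l.toLieSubalgebra →ₗ⁅K⁆ LieDual K g :=
  { s.extendDual with
    map_lie' := by
      intro lam mu
      apply LieDual.ext
      intro x
      change toDual (s.extendDual ⁅lam, mu⁆) x = toDual ⁅s.extendDual lam, s.extendDual mu⁆ x
      rw [extendDual_apply, LieDual.lie_apply, LieDual.lie_apply, ev2_extendDual]
      congr 1
      have hx : x ∈ l.toLieSubalgebra.toSubmodule ⊔ u := by
        rw [s.isCompl.sup_eq_top]; trivial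
      obtain ⟨y, hy, z, hz, rfl⟩ := Submodule.mem_sup.1 hx
      rw [map_add, map_add, map_add, map_add, s.map_projL_cobracket_of_mem hz,
        s.projL_of_mem_u hz, map_zero, add_zero, add_zero]
      have h1 := s.projL_coe ⟨y, hy⟩
      have h2 := l.incl2_cobr ⟨y, hy⟩
      change s.projL y = _ at h1
      change _ = cobracket (K := K) y at h2
      rw [h1, ← h2, map_projL_incl2]
      rfl }

/-- `Ad(x⁻¹)` on `d(g)`, for `x` the generic point of the formal group `L^* ⊆ G^*`. -/
def adInvL : U K (LieDual K l.toLieSubalgebra) →ₗ[K] Module.End K (Double K g) :=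
  adInv ((Double.inr (K := K) (g := g)).comp s.dualIncl)

/-- The pairing `⟨x, ξ⟩` of `x ∈ g` and `ξ ∈ g^*`. -/
def pair : g ⊗[K] LieDual K g →ₗ[K] K :=
  TensorProduct.lift (toDual (K := K) (g := g)).toLinearMap.flip

/-- The function `x ↦ ⟨(Ad(x⁻¹)(v))_g, (Ad(x⁻¹)(w))_{g^*}⟩` on `L^*`, for `v, w ∈ d(g)`. The product
of the matrix coefficients of `Ad(x⁻¹)` is taken in `K[[L^*]]`, that is, as a functional on
`U(l^*)` it is the composite with the coproduct. -/
def omegaDouble (v w : Double K g) : DualFun l :=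
  WithConv.toConv (pair ∘ₗ
    TensorProduct.map (Double.fst ∘ₗ LinearMap.applyₗ v ∘ₗ s.adInvL)
      (Double.snd ∘ₗ LinearMap.applyₗ w ∘ₗ s.adInvL) ∘ₗ Coalgebra.comul)

/-- The `K[[L^*]]`-valued bilinear form
`ω_x(v, w) = ⟨(Ad(x⁻¹)(v))_g, (Ad(x⁻¹)(w))_{g^*}⟩` on `u`. -/
def omega : u →ₗ[K] u →ₗ[K] DualFun l :=
  LinearMap.mk₂ K (fun v w => s.omegaDouble (Double.inl (v : g)) (Double.inl (w : g)))
    (fun v v' w => by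
      simp only [omegaDouble, Submodule.coe_add, map_add, LinearMap.add_comp, LinearMap.comp_add,
        TensorProduct.map_add_left]
      rfl)
    (fun c v w => by
      simp only [omegaDouble, Submodule.coe_smul, map_smul, LinearMap.smul_comp,
        LinearMap.comp_smul, TensorProduct.map_smul_left]
      rfl)
    (fun v w w' => by
      simp only [omegaDouble, Submodule.coe_add, map_add, LinearMap.add_comp, LinearMap.comp_add,
        TensorProduct.map_add_right]
      rfl)
    (fun c v w => by
      simp only [omegaDouble, Submodule.coe_smul, map_smul, LinearMap.smul_comp,
        LinearMap.comp_smul, TensorProduct.map_smul_right]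
      rfl)

/-- The determinant `P_l^g ∈ K[[L^*]]` of `ω_x`, with respect to a basis of `u` (it is well defined up
to a nonzero scalar). -/
def detOmega {ι : Type*} [Fintype ι] [DecidableEq ι] (b : Module.Basis ι K u) : DualFun l :=
  Matrix.det (Matrix.of fun i j => s.omega (b i) (b j))

/-- For `v ∈ u`, the map `a ⊗ b ⊗ ℓ ↦ a ⊗ ω_x(v, b) ℓ`. -/
def contract (P : DualFun l) (v : u) :
    (u ⊗[K] u) ⊗[K] Localization.Away P →ₗ[K] u ⊗[K] Localization.Away P :=
  LinearMap.lTensor u (TensorProduct.lift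
      ((LinearMap.mul K (Localization.Away P)).comp
        ((Algebra.linearMap (DualFun l) (Localization.Away P)).restrictScalars K ∘ₗ s.omega v))) ∘ₗ
    (TensorProduct.assoc K u u (Localization.Away P)).toLinearMap

/-- `σ = (ω_x)⁻¹`: writing `σ = ∑ a_α ⊗ b_α ⊗ ℓ_α`, one has `∑ a_α ⊗ ω_x(v, b_α) ℓ_α = v ⊗ 1` for any
`v ∈ u`. -/
def IsInverse (P : DualFun l) (σ : (u ⊗[K] u) ⊗[K] Localization.Away P) : Prop :=
  ∀ v : u, s.contract P v σ = v ⊗ₜ 1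

end IsSplitting

end Splitting

end PLDyn

end

/-!
A function `f` on a formal group vanishes as soon as it lies in a family of functions which all
vanish at the unit and whose span is stable under left translations: its iterated derivatives at the
unit, which determine it, are then all zero.

Extend `ω` from `u` to all of `g`. With `ξ · v = (ξ ⊗ id)(δ(v))` for `ξ ∈ l^*`, it then satisfies
`L_ξ ω(v, w) = -ω(ξ · v, w) - ω(v, ξ · w) + ξ([w, v])`. As the family formed by the differences of
the two sides is stable under left translations, this gives the antisymmetry of `ω`, its vanishing
on `u × l`, the cyclic identity `∑ (ω(z, [x, y]) + (ω(x, ·) ⊗ ω(y, ·))(δ(z))) = 0`, and its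
invariance under the dressing action. Restricted to a one-parameter subgroup `e^{tλ}`, the
determinant of `ω` on `u` has leading term, up to sign, the determinant of `λ([·, ·]_l)` times a
power of `t`, hence it is nonzero.

Equations (a) and (b) are then tested on tensor products of the functionals `ω(v, ·) + ξ`, with
`v ∈ u` and `ξ ∈ l^*`. Over `K[[L^*]][1/P]` these span all functionals, and the contraction of `σ`
with `ω(v, ·) + ξ` is `v`, so that (a) becomes the invariance of `ω` and (b) its cyclic identity.
-/

noncomputable section

namespace PLDyn

open LieBialgebra LieDual

/-! ### Products of functionals -/

section EvalTensor

variable {K V W R : Type*} [CommRing K] [AddCommGroup V] [Module K V] [AddCommGroup W] [Module K W]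
  [CommRing R] [Algebra K R]

/-- The functional `v ⊗ w ↦ φ(v) ψ(w)`, for functionals `φ`, `ψ` with values in a commutative
algebra `R`. -/
def evalTensor : (V →ₗ[K] R) →ₗ[R] (W →ₗ[K] R) →ₗ[R] (V ⊗[K] W →ₗ[K] R) :=
  LinearMap.mk₂ R (fun φ ψ => LinearMap.mul' K R ∘ₗ TensorProduct.map φ ψ)
    (fun _ _ _ => TensorProduct.ext' fun _ _ => by simp [add_mul])
    (fun _ _ _ => TensorProduct.ext' fun _ _ => by simp [mul_assoc])
    (fun _ _ _ => TensorProduct.ext' fun _ _ => by simp [mul_add])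
    (fun _ _ _ => TensorProduct.ext' fun _ _ => by simp [mul_left_comm])

@[simp] theorem evalTensor_tmul (φ : V →ₗ[K] R) (ψ : W →ₗ[K] R) (v : V) (w : W) :
    evalTensor φ ψ (v ⊗ₜ w) = φ v * ψ w := rfl

theorem evalTensor_comp_comm (φ : V →ₗ[K] R) (ψ : W →ₗ[K] R) :
    evalTensor φ ψ ∘ₗ (TensorProduct.comm K W V).toLinearMap = evalTensor ψ φ :=
  TensorProduct.ext' fun w v => by simp [mul_comm]

theorem derivation_evalTensor (D : Derivation K R R) (φ : V →ₗ[K] R) (ψ : W →ₗ[K] R)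
    (t : V ⊗[K] W) :
    D (evalTensor φ ψ t) =
      evalTensor ((D : R →ₗ[K] R) ∘ₗ φ) ψ t + evalTensor φ ((D : R →ₗ[K] R) ∘ₗ ψ) t := by
  have comp_eq : (D : R →ₗ[K] R) ∘ₗ evalTensor φ ψ =
      evalTensor ((D : R →ₗ[K] R) ∘ₗ φ) ψ + evalTensor φ ((D : R →ₗ[K] R) ∘ₗ ψ) :=
    TensorProduct.ext' fun v w => by simp [add_comm, mul_comm]
  exact LinearMap.congr_fun comp_eq t

theorem span_image2_evalTensor [Module.Free K V] [Module.Finite K V] [Module.Free K W]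
    [Module.Finite K W] {S : Set (V →ₗ[K] R)} {T : Set (W →ₗ[K] R)}
    (hS : Submodule.span R S = ⊤) (hT : Submodule.span R T = ⊤) :
    Submodule.span R (Set.image2 (fun φ ψ => evalTensor φ ψ) S T) = ⊤ := by
  rw [← Submodule.map₂_span_span, hS, hT, eq_top_iff]
  intro f _
  let B := Module.Free.chooseBasis K V
  let C := Module.Free.chooseBasis K W
  have f_eq_sum : f = ∑ i, ∑ j, f (B i ⊗ₜ C j) •
      evalTensor (Algebra.linearMap K R ∘ₗ B.coord i) (Algebra.linearMap K R ∘ₗ C.coord j) :=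
    (B.tensorProduct C).ext fun ⟨i, j⟩ => by
      simp [Module.Basis.tensorProduct_apply, Finsupp.single_apply, LinearMap.sum_apply]
  rw [f_eq_sum]
  exact Submodule.sum_mem _ fun i _ => Submodule.sum_mem _ fun j _ => Submodule.smul_mem _ _
    (Submodule.apply_mem_map₂ _ Submodule.mem_top Submodule.mem_top)

end EvalTensor

section EvalThreefold

variable {K V R : Type*} [Field K] [AddCommGroup V] [Module K V] [CommRing R] [Algebra K R]

theorem evalTensor_comp_cyc (φ ψ χ : V →ₗ[K] R) :
    evalTensor φ (evalTensor ψ χ) ∘ₗ cyc K V = evalTensor χ (evalTensor φ ψ) :=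
  TensorProduct.ext_threefold' fun a b c => by
    simp only [LinearMap.comp_apply, cyc_tmul, evalTensor_tmul]
    ring

theorem evalTensor_comp_alt (φ ψ χ : V →ₗ[K] R) :
    evalTensor φ (evalTensor ψ χ) ∘ₗ alt K V =
      evalTensor φ (evalTensor ψ χ) + evalTensor χ (evalTensor φ ψ) +
        evalTensor ψ (evalTensor χ φ) := by
  rw [alt, LinearMap.comp_add, LinearMap.comp_add, LinearMap.comp_id, ← LinearMap.comp_assoc,
    evalTensor_comp_cyc, evalTensor_comp_cyc]

theorem evalTensor_comp_assoc (φ ψ χ : V →ₗ[K] R) :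
    evalTensor φ (evalTensor ψ χ) ∘ₗ (TensorProduct.assoc K V V V).toLinearMap =
      evalTensor (evalTensor φ ψ) χ :=
  TensorProduct.ext_threefold fun a b c => by simp [mul_assoc]

theorem evalTensor_comp_tensorId (φ ψ χ : V →ₗ[K] R) (f : V →ₗ[K] V ⊗[K] V) :
    evalTensor φ (evalTensor ψ χ) ∘ₗ tensorId f = evalTensor (evalTensor φ ψ ∘ₗ f) χ := by
  rw [tensorId, ← LinearMap.comp_assoc, evalTensor_comp_assoc]
  exact TensorProduct.ext' fun a b => rfl

end EvalThreefold

section ConstDual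

variable {K g R : Type*} [Field K] [LieRing g] [LieAlgebra K g] [CommRing R] [Algebra K R]

/-- The functional `ξ ∈ g^*` as a functional with values in a `K`-algebra `R`. -/
def constDual (R : Type*) [CommRing R] [Algebra K R] (ξ : LieDual K g) : g →ₗ[K] R :=
  Algebra.linearMap K R ∘ₗ toDual ξ

theorem constDual_apply (ξ : LieDual K g) (x : g) :
    constDual R ξ x = algebraMap K R (toDual ξ x) := rfl

theorem evalTensor_constDual_left (ξ : LieDual K g) (ψ : g →ₗ[K] R) :
    evalTensor (constDual R ξ) ψ = ψ ∘ₗ ev1 ξ :=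
  TensorProduct.ext' fun a b => by simp [Algebra.smul_def, constDual_apply]

variable [LieBialgebra K g]

theorem evalTensor_cobracket_swap (φ ψ : g →ₗ[K] R) (x : g) :
    evalTensor φ ψ (cobracket x) = -evalTensor ψ φ (cobracket x) := by
  rw [← evalTensor_comp_comm, LinearMap.comp_apply, LinearEquiv.coe_coe, comm_cobracket, map_neg]

theorem evalTensor_coadG (ξ : LieDual K g) (φ ψ : g →ₗ[K] R) (x : g) :
    evalTensor φ ψ (cobracket (coadG x ξ)) =
      evalTensor (φ ∘ₗ ev1 ξ ∘ₗ cobracket) ψ (cobracket x) +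
        evalTensor φ (ψ ∘ₗ ev1 ξ ∘ₗ cobracket) (cobracket x) := by
  have coJacobi_eval : (evalTensor (constDual R ξ) (evalTensor φ ψ) ∘ₗ alt K g)
      (tensorId cobracket (cobracket x)) = 0 := by
    rw [LinearMap.comp_apply, coJacobi, map_zero]
  have eval_tensorId (α β γ : g →ₗ[K] R) :
      evalTensor α (evalTensor β γ) (tensorId cobracket (cobracket x)) =
        evalTensor (evalTensor α β ∘ₗ cobracket) γ (cobracket x) :=
    LinearMap.congr_fun (evalTensor_comp_tensorId α β γ cobracket) _
  have eval_constDual_right :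
      evalTensor ψ (constDual R ξ) ∘ₗ cobracket = -(ψ ∘ₗ ev1 ξ ∘ₗ cobracket) :=
    LinearMap.ext fun y => by
      rw [LinearMap.comp_apply, evalTensor_cobracket_swap, evalTensor_constDual_left]
      rfl
  have eval_coadG : evalTensor (evalTensor φ ψ ∘ₗ cobracket) (constDual R ξ) (cobracket x) =
      -evalTensor φ ψ (cobracket (coadG x ξ)) := by
    rw [evalTensor_cobracket_swap, evalTensor_constDual_left]
    rfl
  rw [evalTensor_comp_alt, LinearMap.add_apply, LinearMap.add_apply, eval_tensorId, eval_tensorId,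
    eval_tensorId, evalTensor_constDual_left, eval_constDual_right, eval_coadG, map_neg,
    LinearMap.neg_apply, LinearMap.neg_apply, evalTensor_cobracket_swap _ φ, neg_neg,
    LinearMap.comp_assoc] at coJacobi_eval
  linear_combination -coJacobi_eval

theorem derivation_evalTensor_cobracket (D : Derivation K R R) {φ φ' ψ ψ' : g →ₗ[K] R}
    {ξ η ζ : LieDual K g}
    (hφ : (D : R →ₗ[K] R) ∘ₗ φ = -φ' - φ ∘ₗ ev1 ξ ∘ₗ cobracket + constDual R η)
    (hψ : (D : R →ₗ[K] R) ∘ₗ ψ = -ψ' - ψ ∘ₗ ev1 ξ ∘ₗ cobracket + constDual R ζ) (x : g) :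
    D (evalTensor φ ψ (cobracket x)) =
      -evalTensor φ' ψ (cobracket x) - evalTensor φ ψ' (cobracket x) -
        evalTensor φ ψ (cobracket (coadG x ξ)) + ψ (coadG x η) - φ (coadG x ζ) := by
  rw [derivation_evalTensor, hφ, hψ, evalTensor_coadG]
  simp only [map_add, map_sub, map_neg, LinearMap.add_apply, LinearMap.sub_apply,
    LinearMap.neg_apply]
  rw [evalTensor_constDual_left, evalTensor_cobracket_swap _ (constDual R ζ),
    evalTensor_constDual_left]
  simp only [LinearMap.comp_apply, coadG]
  abel

end ConstDual

/-! ### Functions on a formal group -/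

section FormalGroup

attribute [local instance] LieRing.ofAssociativeRing

variable {K a : Type*} [Field K] [LieRing a] [LieAlgebra K a]

local notation "ιU" => UniversalEnvelopingAlgebra.ι K
local notation "𝐋" => leftTrans (K := K)
local notation "𝐑" => rightTrans (K := K)

theorem U.mem_of_mulLeft_mem (S : Submodule K (U K a)) (one_mem : (1 : U K a) ∈ S)
    (mulLeft_mem : ∀ x : a, ∀ X ∈ S, ιU x * X ∈ S) (X : U K a) : X ∈ S := by
  let stabilizer : Subalgebra K (U K a) :=
    { carrier := {Y | ∀ X ∈ S, Y * X ∈ S}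
      mul_mem' := fun hY hZ X hX => by rw [mul_assoc]; exact hY _ (hZ _ hX)
      add_mem' := fun hY hZ X hX => by rw [add_mul]; exact S.add_mem (hY _ hX) (hZ _ hX)
      algebraMap_mem' := fun c X hX => by rw [← Algebra.smul_def]; exact S.smul_mem _ hX }
  let j : a →ₗ⁅K⁆ stabilizer :=
    { toFun := fun x => ⟨ιU x, mulLeft_mem x⟩
      map_add' := fun x y => Subtype.ext (map_add _ x y)
      map_smul' := fun c x => Subtype.ext (map_smul _ c x)
      map_lie' := fun {x y} => Subtype.ext (LieHom.map_lie _ x y) }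
  have val_comp_lift :
      stabilizer.val.comp (UniversalEnvelopingAlgebra.lift K j) = AlgHom.id K (U K a) :=
    U.hom_ext fun x => by rw [AlgHom.comp_apply, UniversalEnvelopingAlgebra.lift_ι_apply]; rfl
  have X_mem : X ∈ stabilizer := by
    rw [← AlgHom.id_apply (R := K) X, ← val_comp_lift]
    exact (UniversalEnvelopingAlgebra.lift K j X).2
  simpa using X_mem 1 one_mem

theorem leftTrans_apply (x : a) (f : FormalFun K a) (X : U K a) :
    (𝐋 x f).ofConv X = -f.ofConv (ιU x * X) := rfl

theorem rightTrans_apply (x : a) (f : FormalFun K a) (X : U K a) :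
    (𝐑 x f).ofConv X = f.ofConv (X * ιU x) := rfl

theorem leftTrans_rightTrans_comm (x y : a) (f : FormalFun K a) : 𝐋 x (𝐑 y f) = 𝐑 y (𝐋 x f) :=
  WithConv.ofConv_injective <| LinearMap.ext fun X => by
    simp only [leftTrans_apply, rightTrans_apply, mul_assoc]

theorem leftTrans_lie (x y : a) (f : FormalFun K a) :
    𝐋 ⁅x, y⁆ f = 𝐋 x (𝐋 y f) - 𝐋 y (𝐋 x f) :=
  WithConv.ofConv_injective <| LinearMap.ext fun X => by
    simp only [WithConv.ofConv_sub, LinearMap.sub_apply, leftTrans_apply, LieHom.map_lie,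
      LieRing.of_associative_ring_bracket, sub_mul, map_sub, mul_assoc]
    ring

theorem FormalFun.mul_apply_one (f h : FormalFun K a) :
    (f * h).ofConv 1 = f.ofConv 1 * h.ofConv 1 := by
  rw [FormalFun.mul_apply, map_one, Algebra.TensorProduct.one_def]
  simp

theorem FormalFun.algebraMap_apply_one (c : K) :
    (algebraMap K (FormalFun K a) c).ofConv 1 = c := by
  rw [Algebra.algebraMap_eq_smul_one, WithConv.ofConv_smul, LinearMap.smul_apply]
  change c • algebraMap K K (U.counit K a 1) = c
  simp

/-- Evaluation of functions at the unit of the formal group. -/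
def FormalFun.evalOne : FormalFun K a →ₗ[K] K where
  toFun f := f.ofConv 1
  map_add' _ _ := rfl
  map_smul' _ _ := rfl

-- A function is determined by its iterated left derivatives at the unit.
theorem FormalFun.eq_zero_of_leftTrans_mem_span {E : Type*} (F : E → FormalFun K a)
    (apply_one : ∀ e, (F e).ofConv 1 = 0)
    (leftTrans_mem : ∀ (x : a) (e : E), 𝐋 x (F e) ∈ Submodule.span K (Set.range F)) (e : E) :
    F e = 0 := by
  have span_apply_one : Submodule.span K (Set.range F) ≤ LinearMap.ker FormalFun.evalOne :=
    Submodule.span_le.2 <| Set.range_subset_iff.2 apply_one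
  have leftTrans_span (x : a) : Submodule.span K (Set.range F) ≤
      (Submodule.span K (Set.range F)).comap (𝐋 x : FormalFun K a →ₗ[K] FormalFun K a) :=
    Submodule.span_le.2 <| Set.range_subset_iff.2 (leftTrans_mem x)
  let zeros : Submodule K (U K a) :=
    { carrier := {X | ∀ f ∈ Submodule.span K (Set.range F), f.ofConv X = 0}
      zero_mem' := fun f _ => map_zero _
      add_mem' := fun hX hY f hf => by rw [map_add, hX f hf, hY f hf, add_zero]
      smul_mem' := fun c X hX f hf => by rw [map_smul, hX f hf, smul_zero] }
  have mem_zeros : ∀ X, X ∈ zeros :=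
    U.mem_of_mulLeft_mem zeros (fun f hf => span_apply_one hf) fun x X hX f hf =>
      neg_eq_zero.1 (hX _ (leftTrans_span x hf))
  exact WithConv.ofConv_injective <| LinearMap.ext fun X =>
    mem_zeros X _ (Submodule.subset_span ⟨e, rfl⟩)

theorem U.map_comul_ι_mul {M N : Type*} [AddCommGroup M] [Module K M] [AddCommGroup N]
    [Module K N] (α : U K a →ₗ[K] M) (β : U K a →ₗ[K] N) (x : a) (X : U K a) :
    TensorProduct.map α β (U.comul K a (ιU x * X)) =
      TensorProduct.map (α ∘ₗ LinearMap.mulLeft K (ιU x)) β (U.comul K a X) +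
        TensorProduct.map α (β ∘ₗ LinearMap.mulLeft K (ιU x)) (U.comul K a X) := by
  rw [map_mul, U.comul_ι, add_mul, map_add]
  congr 1 <;> induction U.comul K a X with
  | zero => simp
  | tmul Y Z => simp [-UniversalEnvelopingAlgebra.ι_apply]
  | add s t hs ht => rw [mul_add, map_add, hs, ht, map_add]

section Ad

variable {b : Type*} [LieRing b] [LieAlgebra K b] (φ : a →ₗ⁅K⁆ b)

theorem adInv_one : adInv φ 1 = 1 := by
  simp [adInv]

theorem adInv_ι_mul (x : a) (X : U K a) (v : b) :
    adInv φ (ιU x * X) v = -adInv φ X ⁅φ x, v⁆ := by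
  have antipode_ι : U.antipode K a (ιU x) = -MulOpposite.op (ιU x) :=
    UniversalEnvelopingAlgebra.lift_ι_apply K _ x
  simp only [adInv, LinearMap.comp_apply, AlgHom.toLinearMap_apply, map_mul, antipode_ι,
    LinearEquiv.coe_coe, MulOpposite.coe_opLinearEquiv_symm, MulOpposite.unop_mul,
    MulOpposite.unop_neg, MulOpposite.unop_op, map_neg, UniversalEnvelopingAlgebra.lift_ι_apply,
    Module.End.mul_apply, LinearMap.neg_apply, LieHom.comp_apply, LieAlgebra.ad_apply]

end Ad

theorem U.comul_pow (x : a) (n : ℕ) : U.comul K a (ιU x ^ n) =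
    ∑ m ∈ Finset.HasAntidiagonal.antidiagonal n,
      (n.choose m.1 : K) • ((ιU x ^ m.1) ⊗ₜ[K] (ιU x ^ m.2)) := by
  rw [map_pow, U.comul_ι, Commute.add_pow']
  · refine Finset.sum_congr rfl fun m _ => ?_
    rw [Algebra.TensorProduct.tmul_pow, Algebra.TensorProduct.tmul_pow,
      Algebra.TensorProduct.tmul_mul_tmul, one_pow, one_pow, one_mul, mul_one,
      Nat.cast_smul_eq_nsmul]
  · simp [commute_iff_eq, -UniversalEnvelopingAlgebra.ι_apply]

variable [CharZero K]

/-- Restriction of functions to the formal one-parameter subgroup `t ↦ e^{tx}`: the coefficient of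
`t ^ n` is `f(x ^ n) / n!`. -/
def expRestrict (x : a) : FormalFun K a →+* PowerSeries K where
  toFun f := PowerSeries.mk fun n => f.ofConv (ιU x ^ n) / (n.factorial : K)
  map_one' := by
    ext n
    rw [PowerSeries.coeff_mk, PowerSeries.coeff_one]
    change algebraMap K K (U.counit K a (ιU x ^ n)) / _ = _
    rw [map_pow, U.counit_ι]
    split_ifs with h
    · simp [h]
    · simp [zero_pow h]
  map_zero' := PowerSeries.ext fun n => by
    rw [PowerSeries.coeff_mk]
    exact zero_div _
  map_add' f h := PowerSeries.ext fun n => by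
    simp only [map_add, PowerSeries.coeff_mk, WithConv.ofConv_add, LinearMap.add_apply, add_div]
  map_mul' f h := PowerSeries.ext fun n => by
    simp only [PowerSeries.coeff_mul, PowerSeries.coeff_mk]
    rw [FormalFun.mul_apply, U.comul_pow, map_sum, map_sum, Finset.sum_div]
    refine Finset.sum_congr rfl fun m hm => ?_
    obtain rfl := Finset.HasAntidiagonal.mem_antidiagonal.1 hm
    have factorial_ne_zero (k : ℕ) : (k.factorial : K) ≠ 0 :=
      Nat.cast_ne_zero.2 k.factorial_ne_zero
    have choose_eq : ((m.1 + m.2).choose m.1 : K) =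
        (m.1 + m.2).factorial / (m.1.factorial * m.2.factorial) := by
      rw [Nat.choose_symm_add, Nat.add_choose, Nat.cast_div_charZero
        (Nat.factorial_mul_factorial_dvd_factorial_add _ _), Nat.cast_mul]
    simp only [map_smul, TensorProduct.map_tmul, LinearMap.mul'_apply, smul_eq_mul, choose_eq]
    field_simp [factorial_ne_zero]

theorem coeff_expRestrict (x : a) (f : FormalFun K a) (n : ℕ) :
    PowerSeries.coeff n (expRestrict x f) = f.ofConv (ιU x ^ n) / (n.factorial : K) :=
  PowerSeries.coeff_mk n fun n => f.ofConv (ιU x ^ n) / (n.factorial : K)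

theorem det_ne_zero_of_det_apply_ι_ne_zero {ι : Type*} [Fintype ι] [DecidableEq ι]
    (M : Matrix ι ι (FormalFun K a)) (apply_one : ∀ i j, (M i j).ofConv 1 = 0) (x : a)
    (hx : (Matrix.of fun i j => (M i j).ofConv (ιU x)).det ≠ 0) : M.det ≠ 0 := by
  have X_dvd (i j : ι) : PowerSeries.X ∣ expRestrict x (M i j) := by
    simp [PowerSeries.X_dvd_iff, ← PowerSeries.coeff_zero_eq_constantCoeff_apply,
      coeff_expRestrict, apply_one]
  choose N hN using X_dvd
  have map_M : (expRestrict x).mapMatrix M = (PowerSeries.X : PowerSeries K) • Matrix.of N :=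
    Matrix.ext hN
  have map_N : PowerSeries.constantCoeff.mapMatrix (Matrix.of N) =
      Matrix.of fun i j => (M i j).ofConv (ιU x) := by
    ext i j
    have coeff_one := congrArg (PowerSeries.coeff (0 + 1)) (hN i j)
    rw [coeff_expRestrict, PowerSeries.coeff_succ_X_mul] at coeff_one
    simpa using coeff_one.symm
  rintro hM
  have det_N : (Matrix.of N).det = 0 := by
    have h := congrArg (expRestrict x) hM
    rw [RingHom.map_det, map_M, Matrix.det_smul, map_zero] at h
    exact (mul_eq_zero.1 h).resolve_left (pow_ne_zero _ PowerSeries.X_ne_zero)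
  exact hx (by rw [← map_N, ← RingHom.map_det, det_N, map_zero])

end FormalGroup

/-! ### The form `ω` -/

section Coadjoint

variable {K g : Type*} [Field K] [LieRing g] [LieAlgebra K g]

theorem ev1_mapIncl_mem (ξ : LieDual K g) {p q : Submodule K g} (t : p ⊗[K] q) :
    ev1 ξ (TensorProduct.mapIncl p q t) ∈ q := by
  induction t with
  | zero => simp
  | tmul a b => exact q.smul_mem _ b.2
  | add x y hx hy => rw [map_add, map_add]; exact q.add_mem hx hy

theorem ev1_mapIncl_eq_zero {ξ : LieDual K g} {p q : Submodule K g}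
    (hξ : ∀ x ∈ p, toDual ξ x = 0) (t : p ⊗[K] q) : ev1 ξ (TensorProduct.mapIncl p q t) = 0 := by
  induction t with
  | zero => simp
  | tmul a b =>
    change toDual ξ (a : g) • (b : g) = 0
    rw [hξ a a.2, zero_smul]
  | add x y hx hy => rw [map_add, map_add, hx, hy, add_zero]

variable [LieBialgebra K g]

theorem toDual_coadG (x : g) (ξ η : LieDual K g) : toDual η (coadG x ξ) = toDual ⁅ξ, η⁆ x :=
  toDual_ev1 ξ η _

theorem coadG_of_vanish (l : LieSubbialgebra K g) {η : LieDual K g}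
    (hη : ∀ x ∈ l.toLieSubalgebra, toDual η x = 0) (a : l.toLieSubalgebra) :
    coadG (a : g) η = 0 := by
  obtain ⟨t, ht⟩ := l.cobracket_mem' a.1 a.2
  rw [coadG, ← ht]
  exact ev1_mapIncl_eq_zero hη t

variable [CharZero K]

theorem Double.fst_lie_inr (ξ : LieDual K g) (v : Double K g) :
    fst ⁅inr ξ, v⁆ = -coadG (fst v) ξ := by
  rw [fst_lie]
  change ⁅(0 : g), _⁆ + coadG 0 _ - coadG _ ξ = _
  simp [coadG]

theorem Double.lie_inr_inl (ξ : LieDual K g) (x : g) :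
    ⁅(inr ξ : Double K g), inl x⁆ = inl (-coadG x ξ) + inr (-coadD x ξ) := by
  apply Double.ext
  · rw [fst_lie_inr, map_add]
    exact (add_zero _).symm
  · rw [snd_lie, map_add]
    change ⁅ξ, 0⁆ + coadD 0 0 - coadD x ξ = 0 + -coadD x ξ
    have coadD_zero : coadD (0 : g) (0 : LieDual K g) = 0 := LieDual.ext fun z => by simp
    rw [lie_zero, coadD_zero, add_zero, zero_sub, zero_add]

end Coadjoint

namespace IsSplitting

section Splitting

variable {K g : Type*} [Field K] [LieRing g] [LieAlgebra K g] [LieBialgebra K g]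
  {l : LieSubbialgebra K g} {u : Submodule K g} (s : IsSplitting l u)

theorem extendDual_of_mem_u (ξ : LieDual K l.toLieSubalgebra) {v : g} (hv : v ∈ u) :
    toDual (s.extendDual ξ) v = 0 := by
  rw [extendDual_apply, s.projL_of_mem_u hv, map_zero]

theorem extendDual_coe (ξ : LieDual K l.toLieSubalgebra) (a : l.toLieSubalgebra) :
    toDual (s.extendDual ξ) (a : g) = toDual ξ a := by
  rw [extendDual_apply, s.projL_coe]

/-- The coadjoint action `x ↦ (ξ ⊗ id)(δ(x))` of `ξ ∈ l^*` on `g`. It is minus the usual action,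
`[ξ, x]_g = -(ξ ⊗ id)(δ(x))` in the double. -/
def coadL (ξ : LieDual K l.toLieSubalgebra) : g →ₗ[K] g :=
  ev1 (s.extendDual ξ) ∘ₗ cobracket

theorem coadL_apply (ξ : LieDual K l.toLieSubalgebra) (x : g) :
    s.coadL ξ x = coadG x (s.extendDual ξ) := rfl

theorem coadL_mem_u (ξ : LieDual K l.toLieSubalgebra) {v : g} (hv : v ∈ u) :
    s.coadL ξ v ∈ u := by
  have le_comap : LinearMap.range (TensorProduct.mapIncl l.toLieSubalgebra.toSubmodule u) ⊔
      LinearMap.range (TensorProduct.mapIncl u l.toLieSubalgebra.toSubmodule) ⊔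
      LinearMap.range (TensorProduct.mapIncl u u) ≤ u.comap (ev1 (s.extendDual ξ)) := by
    refine sup_le (sup_le ?_ ?_) ?_
    · rintro _ ⟨t, rfl⟩; exact ev1_mapIncl_mem _ t
    · rintro _ ⟨t, rfl⟩
      rw [Submodule.mem_comap, ev1_mapIncl_eq_zero fun x hx => s.extendDual_of_mem_u ξ hx]
      exact u.zero_mem
    · rintro _ ⟨t, rfl⟩; exact ev1_mapIncl_mem _ t
  exact le_comap (s.cobracket_mem v hv)

theorem coe_coadG (ξ : LieDual K l.toLieSubalgebra) (a : l.toLieSubalgebra) :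
    ((coadG a ξ : l.toLieSubalgebra) : g) = s.coadL ξ (a : g) := by
  have coe_ev1 : l.toLieSubalgebra.toSubmodule.subtype ∘ₗ ev1 ξ =
      ev1 (s.extendDual ξ) ∘ₗ l.incl2 := TensorProduct.ext' fun a b => by
    change ((toDual ξ a • b : l.toLieSubalgebra) : g) = toDual (s.extendDual ξ) (a : g) • (b : g)
    rw [s.extendDual_coe]
    rfl
  rw [coadL_apply, coadG, coadG, ← l.incl2_cobr]
  exact LinearMap.congr_fun coe_ev1 _

theorem coadL_lie (ξ : LieDual K l.toLieSubalgebra) (x y : g) :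
    s.coadL ξ ⁅x, y⁆ = ⁅x, s.coadL ξ y⁆ + ⁅s.coadL ξ x, y⁆ +
      coadG x (coadD y (s.extendDual ξ)) - coadG y (coadD x (s.extendDual ξ)) := by
  rw [coadL_apply, coadG_lie_left, coadL_apply, coadL_apply, ← lie_skew y]
  abel

end Splitting

variable {K g : Type*} [Field K] [CharZero K] [LieRing g] [LieAlgebra K g] [LieBialgebra K g]
  {l : LieSubbialgebra K g} {u : Submodule K g} (s : IsSplitting l u)

local notation "𝐋" => leftTrans (K := K)
local notation "ιU" => UniversalEnvelopingAlgebra.ι K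

section Double

theorem adInvL_one : s.adInvL 1 = 1 := adInv_one _

theorem adInvL_ι_mul (ξ : LieDual K l.toLieSubalgebra) (X : U K (LieDual K l.toLieSubalgebra))
    (v : Double K g) :
    s.adInvL (ιU ξ * X) v = -s.adInvL X ⁅Double.inr (s.extendDual ξ), v⁆ :=
  adInv_ι_mul _ ξ X v

theorem fst_adInvL_inr (X : U K (LieDual K l.toLieSubalgebra)) (η : LieDual K g) :
    Double.fst (s.adInvL X (Double.inr η)) = 0 := by
  let S : Submodule K (U K (LieDual K l.toLieSubalgebra)) :=
    { carrier := {X | ∀ η : LieDual K g, Double.fst (s.adInvL X (Double.inr η)) = 0}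
      zero_mem' := fun η => by simp
      add_mem' := fun {X Y} hX hY η => by
        rw [map_add, LinearMap.add_apply, map_add, hX, hY, add_zero]
      smul_mem' := fun c X hX η => by
        rw [map_smul, LinearMap.smul_apply, map_smul, hX, smul_zero] }
  refine U.mem_of_mulLeft_mem S (fun η => ?_) (fun ξ X hX η => ?_) X η
  · rw [adInvL_one]; rfl
  · rw [adInvL_ι_mul, ← LieHom.map_lie, map_neg, hX, neg_zero]

/-- `omegaDouble` as a bilinear map. -/
def omegaDoubleBilin : Double K g →ₗ[K] Double K g →ₗ[K] DualFun l :=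
  LinearMap.mk₂ K (fun v w => s.omegaDouble v w)
    (fun v v' w => by
      simp only [omegaDouble, map_add, LinearMap.add_comp, LinearMap.comp_add,
        TensorProduct.map_add_left]
      rfl)
    (fun c v w => by
      simp only [omegaDouble, map_smul, LinearMap.smul_comp, LinearMap.comp_smul,
        TensorProduct.map_smul_left]
      rfl)
    (fun v w w' => by
      simp only [omegaDouble, map_add, LinearMap.add_comp, LinearMap.comp_add,
        TensorProduct.map_add_right]
      rfl)
    (fun c v w => by
      simp only [omegaDouble, map_smul, LinearMap.smul_comp, LinearMap.comp_smul,
        TensorProduct.map_smul_right]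
      rfl)

theorem omegaDoubleBilin_apply (v w : Double K g) (X : U K (LieDual K l.toLieSubalgebra)) :
    (s.omegaDoubleBilin v w).ofConv X =
      pair (TensorProduct.map (Double.fst ∘ₗ LinearMap.applyₗ v ∘ₗ s.adInvL)
        (Double.snd ∘ₗ LinearMap.applyₗ w ∘ₗ s.adInvL) (U.comul K _ X)) := rfl

theorem omegaDoubleBilin_apply_one (v w : Double K g) :
    (s.omegaDoubleBilin v w).ofConv 1 = toDual (Double.snd w) (Double.fst v) := by
  rw [omegaDoubleBilin_apply, map_one, Algebra.TensorProduct.one_def, TensorProduct.map_tmul]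
  simp only [LinearMap.comp_apply, LinearMap.applyₗ_apply_apply, adInvL_one, Module.End.one_apply]
  rfl

theorem leftTrans_omegaDoubleBilin (ξ : LieDual K l.toLieSubalgebra) (v w : Double K g) :
    𝐋 ξ (s.omegaDoubleBilin v w) =
      s.omegaDoubleBilin ⁅Double.inr (s.extendDual ξ), v⁆ w +
        s.omegaDoubleBilin v ⁅Double.inr (s.extendDual ξ), w⁆ := by
  have comp_mulLeft (v : Double K g) : (LinearMap.applyₗ v ∘ₗ s.adInvL) ∘ₗ
      LinearMap.mulLeft K (ιU ξ) =
        (-1 : K) • (LinearMap.applyₗ ⁅Double.inr (s.extendDual ξ), v⁆ ∘ₗ s.adInvL) :=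
    LinearMap.ext fun X => (s.adInvL_ι_mul ξ X v).trans (neg_one_smul K _).symm
  refine WithConv.ofConv_injective <| LinearMap.ext fun X => ?_
  rw [leftTrans_apply, WithConv.ofConv_add, LinearMap.add_apply]
  simp only [omegaDoubleBilin_apply]
  rw [U.map_comul_ι_mul, LinearMap.comp_assoc, comp_mulLeft, LinearMap.comp_assoc, comp_mulLeft,
    LinearMap.comp_smul, LinearMap.comp_smul, TensorProduct.map_smul_left,
    TensorProduct.map_smul_right, LinearMap.smul_apply, LinearMap.smul_apply, ← smul_add,
    map_smul, neg_one_smul, neg_neg, map_add]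

theorem omegaDoubleBilin_inr_left (η : LieDual K g) (w : Double K g) :
    s.omegaDoubleBilin (Double.inr η) w = 0 := by
  have fst_zero : Double.fst ∘ₗ LinearMap.applyₗ (Double.inr η) ∘ₗ s.adInvL = 0 :=
    LinearMap.ext fun X => s.fst_adInvL_inr X η
  change s.omegaDouble (Double.inr η) w = 0
  rw [omegaDouble, fst_zero, TensorProduct.map_zero_left, LinearMap.zero_comp,
    LinearMap.comp_zero]
  rfl

theorem omegaDoubleBilin_inr_right (v : Double K g) (η : LieDual K g) :
    s.omegaDoubleBilin v (Double.inr η) = algebraMap K _ (toDual η (Double.fst v)) := by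
  let F (e : Double K g × LieDual K g) : DualFun l :=
    s.omegaDoubleBilin e.1 (Double.inr e.2) - algebraMap K _ (toDual e.2 (Double.fst e.1))
  suffices h : F (v, η) = 0 from sub_eq_zero.1 h
  refine FormalFun.eq_zero_of_leftTrans_mem_span F (fun e => ?_) (fun ξ e => ?_) (v, η)
  · rw [WithConv.ofConv_sub, LinearMap.sub_apply, omegaDoubleBilin_apply_one,
      FormalFun.algebraMap_apply_one]
    exact sub_self _
  · have leftTrans_F : 𝐋 ξ (F e) = F (⁅Double.inr (s.extendDual ξ), e.1⁆, e.2) +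
        F (e.1, ⁅s.extendDual ξ, e.2⁆) := by
      simp only [F, map_sub, Derivation.map_algebraMap, leftTrans_omegaDoubleBilin,
        Double.fst_lie_inr, map_neg, toDual_coadG, LieHom.map_lie]
      abel
    rw [leftTrans_F]
    exact add_mem (Submodule.subset_span ⟨_, rfl⟩) (Submodule.subset_span ⟨_, rfl⟩)

end Double

/-- The form `ω` on all of `g`. -/
def omegaG : g →ₗ[K] g →ₗ[K] DualFun l :=
  s.omegaDoubleBilin.compl₁₂ Double.inl Double.inl

theorem omegaG_apply (x y : g) :
    s.omegaG x y = s.omegaDoubleBilin (Double.inl x) (Double.inl y) := rfl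

theorem omegaG_apply_one (x y : g) : (s.omegaG x y).ofConv 1 = 0 := by
  rw [omegaG_apply, omegaDoubleBilin_apply_one]
  rfl

theorem leftTrans_omegaG (ξ : LieDual K l.toLieSubalgebra) (x y : g) :
    𝐋 ξ (s.omegaG x y) = -s.omegaG (s.coadL ξ x) y - s.omegaG x (s.coadL ξ y) +
      algebraMap K _ (toDual (s.extendDual ξ) ⁅y, x⁆) := by
  rw [omegaG_apply, leftTrans_omegaDoubleBilin, Double.lie_inr_inl, Double.lie_inr_inl]
  simp only [map_add, LinearMap.add_apply, omegaDoubleBilin_inr_left, omegaDoubleBilin_inr_right,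
    map_neg, LinearMap.neg_apply, omegaG_apply, coadL_apply, neg_zero, add_zero]
  change _ + (_ + -(algebraMap K _ (-toDual (s.extendDual ξ) ⁅y, x⁆))) = _
  rw [map_neg]
  abel

theorem omegaG_apply_ι (ξ : LieDual K l.toLieSubalgebra) (x y : g) :
    (s.omegaG x y).ofConv (ιU ξ) = toDual (s.extendDual ξ) ⁅x, y⁆ := by
  have h := congrArg (fun f : DualFun l => f.ofConv 1) (s.leftTrans_omegaG ξ x y)
  simp only [leftTrans_apply, mul_one, WithConv.ofConv_add, WithConv.ofConv_sub,
    WithConv.ofConv_neg, LinearMap.add_apply, LinearMap.sub_apply, LinearMap.neg_apply,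
    omegaG_apply_one, FormalFun.algebraMap_apply_one] at h
  rw [← lie_skew x y, map_neg]
  linear_combination -h

theorem omegaG_swap (x y : g) : s.omegaG x y = -s.omegaG y x := by
  let F (e : g × g) : DualFun l := s.omegaG e.1 e.2 + s.omegaG e.2 e.1
  suffices h : F (x, y) = 0 from eq_neg_of_add_eq_zero_left h
  refine FormalFun.eq_zero_of_leftTrans_mem_span F (fun e => ?_) (fun ξ e => ?_) (x, y)
  · rw [WithConv.ofConv_add, LinearMap.add_apply, omegaG_apply_one, omegaG_apply_one, add_zero]
  · have leftTrans_F : 𝐋 ξ (F e) = -F (s.coadL ξ e.1, e.2) - F (e.1, s.coadL ξ e.2) := by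
      simp only [F, map_add, leftTrans_omegaG, ← lie_skew e.1 e.2, map_neg]
      abel
    rw [leftTrans_F]
    exact sub_mem (neg_mem (Submodule.subset_span ⟨_, rfl⟩)) (Submodule.subset_span ⟨_, rfl⟩)

theorem omegaG_u_l {v : g} (hv : v ∈ u) (a : l.toLieSubalgebra) : s.omegaG v (a : g) = 0 := by
  let F (e : u × l.toLieSubalgebra) : DualFun l := s.omegaG e.1 e.2
  refine FormalFun.eq_zero_of_leftTrans_mem_span F (fun e => s.omegaG_apply_one _ _)
    (fun ξ e => ?_) (⟨v, hv⟩, a)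
  have leftTrans_F : 𝐋 ξ (F e) = -F (⟨_, s.coadL_mem_u ξ e.1.2⟩, e.2) - F (e.1, coadG e.2 ξ) := by
    simp only [F, leftTrans_omegaG, s.extendDual_of_mem_u ξ (s.lie_mem e.2 e.2.2 _ e.1.2),
      map_zero, add_zero, s.coe_coadG]
  rw [leftTrans_F]
  exact sub_mem (neg_mem (Submodule.subset_span ⟨_, rfl⟩)) (Submodule.subset_span ⟨_, rfl⟩)

theorem detOmega_ne_zero (hs : s.Nondegenerate) {ι : Type*} [Fintype ι] [DecidableEq ι]
    (b : Module.Basis ι K u) : s.detOmega b ≠ 0 := by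
  obtain ⟨lam, hlam⟩ := hs
  refine det_ne_zero_of_det_apply_ι_ne_zero _ (fun i j => s.omegaG_apply_one _ _)
    (toDual.symm lam : LieDual K l.toLieSubalgebra) ?_
  convert (LinearMap.BilinForm.nondegenerate_iff_det_ne_zero b).1 hlam using 2
  ext i j
  rw [LinearMap.BilinForm.toMatrix_apply]
  exact s.omegaG_apply_ι _ _ _

/-! ### Closedness of `ω` -/

theorem leftTrans_comp_omegaG (ξ : LieDual K l.toLieSubalgebra) (x : g) :
    (𝐋 ξ : DualFun l →ₗ[K] DualFun l) ∘ₗ s.omegaG x =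
      -s.omegaG (s.coadL ξ x) - s.omegaG x ∘ₗ s.coadL ξ +
        constDual _ (coadD x (s.extendDual ξ)) := by
  refine LinearMap.ext fun y => ?_
  have h := s.leftTrans_omegaG ξ x y
  rw [← lie_skew, map_neg] at h
  exact h

theorem leftTrans_evalTensor_omegaG (ξ : LieDual K l.toLieSubalgebra) (x y z : g) :
    𝐋 ξ (evalTensor (s.omegaG x) (s.omegaG y) (cobracket z)) =
      -evalTensor (s.omegaG (s.coadL ξ x)) (s.omegaG y) (cobracket z)
      - evalTensor (s.omegaG x) (s.omegaG (s.coadL ξ y)) (cobracket z)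
      - evalTensor (s.omegaG x) (s.omegaG y) (cobracket (s.coadL ξ z))
      + s.omegaG y (coadG z (coadD x (s.extendDual ξ)))
      - s.omegaG x (coadG z (coadD y (s.extendDual ξ))) :=
  derivation_evalTensor_cobracket _ (s.leftTrans_comp_omegaG ξ x) (s.leftTrans_comp_omegaG ξ y) z

/-- The sum over the cyclic permutations of `(x, y, z)` of `ω(z, [x, y])` and
`(ω(x, ·) ⊗ ω(y, ·))(δ(z))`, which measures the failure of `ω` to be closed. -/
def omegaCyc (x y z : g) : DualFun l :=
  s.omegaG z ⁅x, y⁆ + s.omegaG x ⁅y, z⁆ + s.omegaG y ⁅z, x⁆ +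
    evalTensor (s.omegaG x) (s.omegaG y) (cobracket z) +
    evalTensor (s.omegaG y) (s.omegaG z) (cobracket x) +
    evalTensor (s.omegaG z) (s.omegaG x) (cobracket y)

theorem leftTrans_omegaCyc (ξ : LieDual K l.toLieSubalgebra) (x y z : g) :
    𝐋 ξ (s.omegaCyc x y z) = -s.omegaCyc (s.coadL ξ x) y z -
      s.omegaCyc x (s.coadL ξ y) z - s.omegaCyc x y (s.coadL ξ z) := by
  have jacobi := congrArg (fun v => algebraMap K (DualFun l) (toDual (s.extendDual ξ) v))
    (lie_jacobi x y z)
  rw [← lie_skew x ⁅y, z⁆, ← lie_skew y ⁅z, x⁆, ← lie_skew z ⁅x, y⁆] at jacobi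
  simp only [map_add, map_neg, map_zero] at jacobi
  simp only [omegaCyc, map_add, leftTrans_omegaG, leftTrans_evalTensor_omegaG, coadL_lie, map_sub]
  linear_combination -jacobi

theorem evalTensor_apply_one (φ ψ : g →ₗ[K] DualFun l) (hφ : ∀ x, (φ x).ofConv 1 = 0)
    (t : g ⊗[K] g) : (evalTensor φ ψ t).ofConv 1 = 0 := by
  induction t with
  | zero => simp
  | tmul a b => rw [evalTensor_tmul, FormalFun.mul_apply_one, hφ, zero_mul]
  | add s t hs ht => rw [map_add, WithConv.ofConv_add, LinearMap.add_apply, hs, ht, add_zero]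

theorem omegaCyc_eq_zero (x y z : g) : s.omegaCyc x y z = 0 := by
  let F (e : g × g × g) : DualFun l := s.omegaCyc e.1 e.2.1 e.2.2
  refine FormalFun.eq_zero_of_leftTrans_mem_span F (fun e => ?_) (fun ξ e => ?_) (x, y, z)
  · simp only [F, omegaCyc, WithConv.ofConv_add, LinearMap.add_apply, omegaG_apply_one,
      evalTensor_apply_one _ _ (s.omegaG_apply_one _), add_zero]
  · have leftTrans_F : 𝐋 ξ (F e) = -F (s.coadL ξ e.1, e.2.1, e.2.2) -
        F (e.1, s.coadL ξ e.2.1, e.2.2) - F (e.1, e.2.1, s.coadL ξ e.2.2) :=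
      s.leftTrans_omegaCyc ξ _ _ _
    rw [leftTrans_F]
    exact sub_mem (sub_mem (neg_mem (Submodule.subset_span ⟨_, rfl⟩))
      (Submodule.subset_span ⟨_, rfl⟩)) (Submodule.subset_span ⟨_, rfl⟩)

end IsSplitting

/-! ### The dressing action -/

section Dressing

theorem sum_dualVec {K h : Type*} [Field K] [LieRing h] [LieAlgebra K h] [FiniteDimensional K h]
    (η : LieDual K h) :
    ∑ i, toDual η (stdBasis K h i) • dualVec K h i = η :=
  (stdBasis K h).sum_dual_apply_smul_coord (toDual η)

variable {K h : Type*} [Field K] [CharZero K] [LieRing h] [LieAlgebra K h] [LieBialgebra K h]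

local notation "𝐋" => leftTrans (K := K)
local notation "ιU" => UniversalEnvelopingAlgebra.ι K

/-- The function `x ↦ ⟨(Ad(x⁻¹)(y))_{h^*}, z⟩` on the formal group `H^*`, as a linear function of
`y` in the double. -/
def dressCoeff (z : h) : Double K h →ₗ[K] FormalFun K (LieDual K h) where
  toFun y := WithConv.toConv
    (LinearMap.applyₗ z ∘ₗ (toDual (K := K) (g := h)).toLinearMap ∘ₗ Double.snd ∘ₗ
      LinearMap.applyₗ y ∘ₗ adInv (Double.inr (K := K) (g := h)))
  map_add' y y' := by
    simp only [map_add, LinearMap.add_comp, LinearMap.comp_add]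
    rfl
  map_smul' c y := by
    simp only [map_smul, LinearMap.smul_comp, LinearMap.comp_smul]
    rfl

theorem leftTrans_dressCoeff (z : h) (ξ : LieDual K h) (y : Double K h) :
    𝐋 ξ (dressCoeff z y) = dressCoeff z ⁅Double.inr ξ, y⁆ :=
  WithConv.ofConv_injective <| LinearMap.ext fun X => by
    rw [leftTrans_apply]
    change -toDual (Double.snd (adInv Double.inr (ιU ξ * X) y)) _ =
      toDual (Double.snd (adInv Double.inr X ⁅Double.inr ξ, y⁆)) _
    rw [adInv_ι_mul, map_neg, map_neg, LinearMap.neg_apply, neg_neg]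

theorem dressCoeff_apply_one (z : h) (y : Double K h) :
    (dressCoeff z y).ofConv 1 = toDual (Double.snd y) z := by
  change toDual (Double.snd (adInv Double.inr 1 y)) _ = _
  rw [adInv_one]
  rfl

variable [FiniteDimensional K h]

/-- The derivation `f ↦ (x ↦ (R_{(Ad(x⁻¹)(y))_{h^*}} f)(x))`, as a linear function of `y` in the
double. On `h` it is minus the dressing action. -/
def dressD : Double K h →ₗ[K]
    Derivation K (FormalFun K (LieDual K h)) (FormalFun K (LieDual K h)) :=
  ∑ i, (dressCoeff (stdBasis K h i)).smulRight (rightTrans (dualVec K h i))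

theorem dressD_apply (y : Double K h) (f : FormalFun K (LieDual K h)) :
    dressD y f =
      ∑ i, dressCoeff (stdBasis K h i) y * rightTrans (K := K) (dualVec K h i) f := by
  rw [dressD, LinearMap.sum_apply, ← Derivation.coeFnAddMonoidHom_apply, map_sum, Finset.sum_apply]
  rfl

theorem dressL_eq (a : h) : dressL a = -dressD (K := K) (Double.inl a) := by
  rw [dressD, LinearMap.sum_apply]
  rfl

theorem leftTrans_dressD (ξ : LieDual K h) (y : Double K h) (f : FormalFun K (LieDual K h)) :
    𝐋 ξ (dressD y f) = dressD ⁅Double.inr ξ, y⁆ f + dressD y (𝐋 ξ f) := by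
  simp only [dressD_apply, map_sum, Derivation.leibniz, smul_eq_mul, leftTrans_dressCoeff,
    leftTrans_rightTrans_comm, Finset.sum_add_distrib]
  rw [add_comm]
  simp only [mul_comm]

theorem dressD_inr_apply_one (η : LieDual K h) (f : FormalFun K (LieDual K h)) :
    (dressD (Double.inr η) f).ofConv 1 = f.ofConv (ιU η) := by
  conv_rhs => rw [← sum_dualVec η]
  rw [dressD_apply, WithConv.ofConv_sum, LinearMap.sum_apply, map_sum, map_sum]
  refine Finset.sum_congr rfl fun i _ => ?_
  rw [FormalFun.mul_apply_one, dressCoeff_apply_one, rightTrans_apply, one_mul, map_smul, map_smul]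
  rfl

theorem dressD_inl_apply_one (a : h) (f : FormalFun K (LieDual K h)) :
    (dressD (K := K) (Double.inl a) f).ofConv 1 = 0 := by
  rw [dressD_apply, WithConv.ofConv_sum, LinearMap.sum_apply]
  refine Finset.sum_eq_zero fun i _ => ?_
  rw [FormalFun.mul_apply_one, dressCoeff_apply_one]
  exact zero_mul _

theorem dressD_inr (η : LieDual K h) (f : FormalFun K (LieDual K h)) :
    dressD (Double.inr η) f = -𝐋 η f := by
  let F (e : LieDual K h × FormalFun K (LieDual K h)) : FormalFun K (LieDual K h) :=
    dressD (Double.inr e.1) e.2 + 𝐋 e.1 e.2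
  suffices vanish : F (η, f) = 0 from eq_neg_of_add_eq_zero_left vanish
  refine FormalFun.eq_zero_of_leftTrans_mem_span F (fun e => ?_) (fun ξ e => ?_) (η, f)
  · rw [WithConv.ofConv_add, LinearMap.add_apply, dressD_inr_apply_one, leftTrans_apply, mul_one,
      add_neg_cancel]
  · have leftTrans_F : 𝐋 ξ (F e) = F (⁅ξ, e.1⁆, e.2) + F (e.1, 𝐋 ξ e.2) := by
      simp only [F, map_add, leftTrans_dressD, leftTrans_lie, LieHom.map_lie]
      abel
    rw [leftTrans_F]
    exact add_mem (Submodule.subset_span ⟨_, rfl⟩) (Submodule.subset_span ⟨_, rfl⟩)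

end Dressing

namespace IsSplitting

section Splitting

variable {K g : Type*} [Field K] [LieRing g] [LieAlgebra K g] [LieBialgebra K g]
  {l : LieSubbialgebra K g} {u : Submodule K g} (s : IsSplitting l u)

theorem projL_lie (a : l.toLieSubalgebra) (x : g) : s.projL ⁅(a : g), x⁆ = ⁅a, s.projL x⁆ := by
  have hx : x ∈ l.toLieSubalgebra.toSubmodule ⊔ u := by
    rw [s.isCompl.sup_eq_top]; trivial
  obtain ⟨y, hy, z, hz, rfl⟩ := Submodule.mem_sup.1 hx
  rw [lie_add, map_add, map_add, s.projL_of_mem_u hz,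
    s.projL_of_mem_u (s.lie_mem a.1 a.2 z hz), add_zero, add_zero,
    show s.projL y = ⟨y, hy⟩ from s.projL_coe ⟨y, hy⟩]
  exact s.projL_coe ⁅a, ⟨y, hy⟩⁆

theorem extendDual_coadD (a : l.toLieSubalgebra) (ξ : LieDual K l.toLieSubalgebra) :
    s.extendDual (coadD a ξ) = coadD (a : g) (s.extendDual ξ) :=
  LieDual.ext fun x => by
    rw [extendDual_apply, coadD_apply, coadD_apply, extendDual_apply, projL_lie]

theorem coadL_lie_of_mem_u (ξ : LieDual K l.toLieSubalgebra) (a : l.toLieSubalgebra) {v : g}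
    (hv : v ∈ u) : s.coadL ξ ⁅(a : g), v⁆ = ⁅(a : g), s.coadL ξ v⁆ +
      ⁅((coadG a ξ : l.toLieSubalgebra) : g), v⁆ - s.coadL (coadD a ξ) v := by
  have coadD_vanish : ∀ z ∈ l.toLieSubalgebra, toDual (coadD v (s.extendDual ξ)) z = 0 :=
    fun z hz => by
      rw [coadD_apply, ← lie_skew, map_neg, neg_neg]
      exact s.extendDual_of_mem_u ξ (s.lie_mem z hz v hv)
  rw [coadL_lie, coadG_of_vanish l coadD_vanish a, add_zero, ← extendDual_coadD, s.coe_coadG]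
  rfl

end Splitting

variable {K g : Type*} [Field K] [CharZero K] [LieRing g] [LieAlgebra K g] [LieBialgebra K g]
  [FiniteDimensional K g] {l : LieSubbialgebra K g} {u : Submodule K g} (s : IsSplitting l u)

local notation "𝐋" => leftTrans (K := K)

theorem dressD_omegaG (a : l.toLieSubalgebra) {x y : g} (hx : x ∈ u) (hy : y ∈ u) :
    dressD (K := K) (Double.inl a) (s.omegaG x y) =
      -s.omegaG ⁅(a : g), x⁆ y - s.omegaG x ⁅(a : g), y⁆ := by
  let F (e : l.toLieSubalgebra × u × u) : DualFun l :=
    dressD (K := K) (Double.inl e.1) (s.omegaG e.2.1 e.2.2) +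
      s.omegaG ⁅(e.1 : g), (e.2.1 : g)⁆ e.2.2 + s.omegaG e.2.1 ⁅(e.1 : g), (e.2.2 : g)⁆
  suffices vanish : F (a, ⟨x, hx⟩, ⟨y, hy⟩) = 0 by linear_combination vanish
  refine FormalFun.eq_zero_of_leftTrans_mem_span F (fun e => ?_) (fun ξ ⟨a, x, y⟩ => ?_) _
  · simp only [F, WithConv.ofConv_add, LinearMap.add_apply, omegaG_apply_one,
      dressD_inl_apply_one, add_zero]
  · have lie_eq : toDual (s.extendDual ξ) ⁅(y : g), ⁅(a : g), (x : g)⁆⁆ +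
        toDual (s.extendDual ξ) ⁅⁅(a : g), (y : g)⁆, (x : g)⁆ =
          -toDual (s.extendDual (coadD a ξ)) ⁅(y : g), (x : g)⁆ := by
      rw [extendDual_coadD, coadD_apply, neg_neg, leibniz_lie (a : g), map_add, add_comm]
    have lie_eq' := congrArg (algebraMap K (DualFun l)) lie_eq
    rw [map_add, map_neg] at lie_eq'
    have leftTrans_F : 𝐋 ξ (F (a, x, y)) = -F (coadG a ξ, x, y) -
        F (a, ⟨_, s.coadL_mem_u ξ x.2⟩, y) - F (a, x, ⟨_, s.coadL_mem_u ξ y.2⟩) := by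
      simp only [F, map_sub, map_neg, leftTrans_dressD, Double.lie_inr_inl,
        dressD_inr, leftTrans_omegaG, map_add, Derivation.map_algebraMap,
        s.coadL_lie_of_mem_u ξ a x.2, s.coadL_lie_of_mem_u ξ a y.2,
        LinearMap.add_apply, LinearMap.sub_apply, Derivation.add_apply, Derivation.neg_apply]
      linear_combination lie_eq'
    rw [leftTrans_F]
    exact sub_mem (sub_mem (neg_mem (Submodule.subset_span ⟨_, rfl⟩))
      (Submodule.subset_span ⟨_, rfl⟩)) (Submodule.subset_span ⟨_, rfl⟩)

end IsSplitting

/-! ### Tensors with coefficients in a commutative algebra -/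

section Coefficients

variable {K V W V' W' M N R : Type*} [CommRing K] [AddCommGroup V] [Module K V] [AddCommGroup W]
  [Module K W] [AddCommGroup V'] [Module K V'] [AddCommGroup W'] [Module K W'] [AddCommGroup M]
  [Module K M] [AddCommGroup N] [Module K N] [CommRing R] [Algebra K R]

/-- The extension `m ⊗ r ↦ f(m) r` of an `R`-valued functional `f` on `M` to the module `M ⊗ R` of
tensors with coefficients in `R`. -/
def liftCoeff : (M →ₗ[K] R) →ₗ[R] (M ⊗[K] R →ₗ[K] R) where
  toFun f := TensorProduct.lift ((LinearMap.mul K R).comp f)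
  map_add' _ _ := TensorProduct.ext' fun _ _ => by simp
  map_smul' _ _ := TensorProduct.ext' fun _ _ => by simp [mul_assoc]

@[simp] theorem liftCoeff_tmul (f : M →ₗ[K] R) (m : M) (r : R) : liftCoeff f (m ⊗ₜ r) = f m * r :=
  rfl

theorem liftCoeff_rTensor (f : M →ₗ[K] R) (h : N →ₗ[K] M) (t : N ⊗[K] R) :
    liftCoeff f (LinearMap.rTensor R h t) = liftCoeff (f ∘ₗ h) t :=
  LinearMap.congr_fun (TensorProduct.ext' fun _ _ => rfl :
    liftCoeff f ∘ₗ LinearMap.rTensor R h = liftCoeff (f ∘ₗ h)) t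

theorem liftCoeff_lTensor (D : Derivation K R R) (f : M →ₗ[K] R) (t : M ⊗[K] R) :
    liftCoeff f (LinearMap.lTensor M (D : R →ₗ[K] R) t) =
      D (liftCoeff f t) - liftCoeff ((D : R →ₗ[K] R) ∘ₗ f) t := by
  have comp_eq : liftCoeff f ∘ₗ LinearMap.lTensor M (D : R →ₗ[K] R) =
      (D : R →ₗ[K] R) ∘ₗ liftCoeff f - liftCoeff ((D : R →ₗ[K] R) ∘ₗ f) :=
    TensorProduct.ext' fun _ _ => by simp [mul_comm]
  exact LinearMap.congr_fun comp_eq t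

theorem eq_zero_of_liftCoeff [Module.Free K M] {S : Set (M →ₗ[K] R)}
    (hS : Submodule.span R S = ⊤) {t : M ⊗[K] R} (ht : ∀ f ∈ S, liftCoeff f t = 0) : t = 0 := by
  have liftCoeff_eq_zero (f : M →ₗ[K] R) : liftCoeff f t = 0 :=
    Submodule.span_induction (p := fun f _ => liftCoeff f t = 0) ht (by simp)
      (fun f f' _ _ hf hf' => by simp [hf, hf']) (fun r f _ hf => by simp [hf])
      (hS ▸ Submodule.mem_top : f ∈ Submodule.span R S)
  let B := Module.Free.chooseBasis K M
  have coeff_eq i : (Finsupp.lapply i ∘ₗ (TensorProduct.equivFinsuppOfBasisLeft B).toLinearMap :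
      M ⊗[K] R →ₗ[K] R) = liftCoeff (Algebra.linearMap K R ∘ₗ B.coord i) :=
    TensorProduct.ext' fun m r => by simp [Algebra.smul_def]
  refine (TensorProduct.equivFinsuppOfBasisLeft B).map_eq_zero_iff.1 (Finsupp.ext fun i => ?_)
  exact (LinearMap.congr_fun (coeff_eq i) t).trans (liftCoeff_eq_zero _)

/-- The contraction `a ⊗ b ⊗ r ↦ a ⊗ φ(b) r` of the last tensor factor with an `R`-valued
functional `φ`. -/
def contractRight (φ : W →ₗ[K] R) : (V ⊗[K] W) ⊗[K] R →ₗ[K] V ⊗[K] R :=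
  LinearMap.lTensor V (liftCoeff φ) ∘ₗ (TensorProduct.assoc K V W R).toLinearMap

@[simp] theorem contractRight_tmul (φ : W →ₗ[K] R) (v : V) (w : W) (r : R) :
    contractRight φ ((v ⊗ₜ w) ⊗ₜ r) = v ⊗ₜ (φ w * r) :=
  rfl

theorem contractRight_rTensor_map (φ : W' →ₗ[K] R) (f : V →ₗ[K] V') (h : W →ₗ[K] W')
    (t : (V ⊗[K] W) ⊗[K] R) :
    contractRight φ (LinearMap.rTensor R (TensorProduct.map f h) t) =
      LinearMap.rTensor R f (contractRight (φ ∘ₗ h) t) :=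
  LinearMap.congr_fun (TensorProduct.ext_threefold fun _ _ _ => rfl :
    contractRight φ ∘ₗ LinearMap.rTensor R (TensorProduct.map f h) =
      LinearMap.rTensor R f ∘ₗ contractRight (φ ∘ₗ h)) t

theorem liftCoeff_evalTensor (φ : V →ₗ[K] R) (ψ : W →ₗ[K] R) (t : (V ⊗[K] W) ⊗[K] R) :
    liftCoeff (evalTensor φ ψ) t = liftCoeff φ (contractRight ψ t) :=
  LinearMap.congr_fun (TensorProduct.ext_threefold fun _ _ _ => by simp [mul_assoc] :
    liftCoeff (evalTensor φ ψ) = liftCoeff φ ∘ₗ contractRight ψ) t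

section Antisymmetric

variable {t : (V ⊗[K] V) ⊗[K] R}
  (ht : LinearMap.rTensor R (TensorProduct.comm K V V).toLinearMap t = -t)
include ht

theorem liftCoeff_evalTensor_swap (φ ψ : V →ₗ[K] R) :
    liftCoeff (evalTensor φ ψ) t = -liftCoeff (evalTensor ψ φ) t := by
  rw [← evalTensor_comp_comm, ← liftCoeff_rTensor, ht, map_neg]

theorem liftCoeff_evalTensor_lTensor (D : Derivation K R R) {φ ψ : V →ₗ[K] R} {x y : V}
    (hφ : contractRight φ t = x ⊗ₜ 1) (hψ : contractRight ψ t = y ⊗ₜ 1) :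
    liftCoeff (evalTensor φ ψ) (LinearMap.lTensor (V ⊗[K] V) (D : R →ₗ[K] R) t) = D (ψ x) := by
  have derivation_comp : (D : R →ₗ[K] R) ∘ₗ evalTensor φ ψ =
      evalTensor ((D : R →ₗ[K] R) ∘ₗ φ) ψ + evalTensor φ ((D : R →ₗ[K] R) ∘ₗ ψ) :=
    LinearMap.ext fun t => derivation_evalTensor D φ ψ t
  rw [liftCoeff_lTensor, derivation_comp, map_add, LinearMap.add_apply,
    liftCoeff_evalTensor_swap ht φ ((D : R →ₗ[K] R) ∘ₗ ψ), liftCoeff_evalTensor,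
    liftCoeff_evalTensor, liftCoeff_evalTensor, hφ, hψ]
  simp

end Antisymmetric

end Coefficients

section Bracket

variable {K g R : Type*} [Field K] [LieRing g] [LieAlgebra K g] [CommRing R] [Algebra K R]

/-- The functional `φ([x, y])` of `x, y ∈ g`, extended bilinearly to tensors with coefficients in
`R`. -/
def bracketEval (φ : g →ₗ[K] R) : g ⊗[K] R →ₗ[K] g ⊗[K] R →ₗ[K] R :=
  (TensorProduct.map₂ (LieModule.toEnd K g g : g →ₗ[K] Module.End K g)
    (LinearMap.mul K R)).compr₂ (liftCoeff φ)

@[simp] theorem bracketEval_tmul (φ : g →ₗ[K] R) (x y : g) (r r' : R) :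
    bracketEval φ (x ⊗ₜ r) (y ⊗ₜ r') = φ ⁅x, y⁆ * (r * r') :=
  rfl

theorem liftCoeff_map₂_br (φ ψ χ : g →ₗ[K] R) (t t' : (g ⊗[K] g) ⊗[K] R) :
    liftCoeff (evalTensor φ (evalTensor ψ χ)) (TensorProduct.map₂
        (br12_13 K g + br12_23 K g + br13_23 K g) (LinearMap.mul K R) t t') =
      bracketEval φ (contractRight ψ t) (contractRight χ t') +
      bracketEval ψ (contractRight φ (LinearMap.rTensor R (TensorProduct.comm K g g).toLinearMap t))
        (contractRight χ t') +
      bracketEval χ (contractRight φ (LinearMap.rTensor R (TensorProduct.comm K g g).toLinearMap t))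
        (contractRight ψ (LinearMap.rTensor R (TensorProduct.comm K g g).toLinearMap t')) := by
  let swap : (g ⊗[K] g) ⊗[K] R →ₗ[K] (g ⊗[K] g) ⊗[K] R :=
    LinearMap.rTensor R (TensorProduct.comm K g g).toLinearMap
  have bilinear_eq : (TensorProduct.map₂ (br12_13 K g + br12_23 K g + br13_23 K g)
        (LinearMap.mul K R)).compr₂ (liftCoeff (evalTensor φ (evalTensor ψ χ))) =
      (bracketEval φ).compl₁₂ (contractRight ψ) (contractRight χ) +
      (bracketEval ψ).compl₁₂ (contractRight φ ∘ₗ swap) (contractRight χ) +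
      (bracketEval χ).compl₁₂ (contractRight φ ∘ₗ swap) (contractRight ψ ∘ₗ swap) :=
    TensorProduct.ext_threefold fun a b r => TensorProduct.ext_threefold fun a' b' r' => by
      simp only [swap, LinearMap.compr₂_apply, TensorProduct.map₂_apply_tmul, LinearMap.add_apply,
        TensorProduct.map_tmul, br12_13_tmul, br12_23_tmul, br13_23_tmul, LinearMap.mul_apply_apply,
        liftCoeff_tmul, map_add, evalTensor_tmul, LinearMap.compl₁₂_apply, contractRight_tmul,
        bracketEval_tmul, LinearMap.coe_comp, Function.comp_apply, LinearMap.rTensor_tmul,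
        LinearEquiv.coe_coe, TensorProduct.comm_tmul]
      ring
  exact LinearMap.congr_fun (LinearMap.congr_fun bilinear_eq t) t'

variable {ρ : (g ⊗[K] g) ⊗[K] R}
  (hρ : LinearMap.rTensor R (TensorProduct.comm K g g).toLinearMap ρ = -ρ)
include hρ

theorem liftCoeff_CYB {φ ψ χ : g →ₗ[K] R} {x y z : g} (hφ : contractRight φ ρ = x ⊗ₜ 1)
    (hψ : contractRight ψ ρ = y ⊗ₜ 1) (hχ : contractRight χ ρ = z ⊗ₜ 1) :
    liftCoeff (evalTensor φ (evalTensor ψ χ)) (CYB ρ) = φ ⁅y, z⁆ + ψ ⁅z, x⁆ + χ ⁅x, y⁆ := by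
  rw [CYB, liftCoeff_map₂_br, hρ, map_neg, map_neg (contractRight ψ), hφ, hψ, hχ, ← lie_skew z x,
    map_neg ψ]
  simp

theorem liftCoeff_evalTensor_toEnd (a : g) {φ ψ : g →ₗ[K] R} {x y : g}
    (hφ : contractRight φ ρ = x ⊗ₜ 1) (hψ : contractRight ψ ρ = y ⊗ₜ 1) :
    liftCoeff (evalTensor φ ψ) (LinearMap.rTensor R (LieModule.toEnd K g (g ⊗[K] g) a) ρ) =
      φ ⁅a, y⁆ - ψ ⁅a, x⁆ := by
  have evalTensor_comp_toEnd : evalTensor φ ψ ∘ₗ LieModule.toEnd K g (g ⊗[K] g) a =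
      evalTensor (φ ∘ₗ LieModule.toEnd K g g a) ψ + evalTensor φ (ψ ∘ₗ LieModule.toEnd K g g a) :=
    TensorProduct.ext' fun x y => by simp [TensorProduct.LieModule.lie_tmul_right]
  rw [liftCoeff_rTensor, evalTensor_comp_toEnd, map_add, LinearMap.add_apply,
    liftCoeff_evalTensor_swap hρ φ, liftCoeff_evalTensor, liftCoeff_evalTensor, hφ, hψ]
  simp [sub_eq_add_neg]

end Bracket

/-! ### Inverting a bilinear form -/

section Wedge

variable {K V W R : Type*} [Field K] [AddCommGroup V] [Module K V] [AddCommGroup W] [Module K W]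
  [CommRing R] [Algebra K R]

theorem mem_range_rTensor_wedge2 {t : (V ⊗[K] V) ⊗[K] R} :
    t ∈ LinearMap.range (LinearMap.rTensor R (wedge2 K V).subtype) ↔
      LinearMap.rTensor R (TensorProduct.comm K V V).toLinearMap t = -t := by
  have wedge2_exact : Function.Exact (LinearMap.rTensor R (wedge2 K V).subtype)
      (LinearMap.rTensor R ((TensorProduct.comm K V V).toLinearMap + LinearMap.id)) :=
    Module.Flat.rTensor_exact R (LinearMap.exact_subtype_ker_map _)
  rw [← LinearMap.exact_iff.1 wedge2_exact, LinearMap.mem_ker, LinearMap.rTensor_add,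
    LinearMap.rTensor_id, LinearMap.add_apply, LinearMap.id_apply, eq_neg_iff_add_eq_zero]

theorem rTensor_comm_rTensor_map (f : V →ₗ[K] W) {t : (V ⊗[K] V) ⊗[K] R}
    (ht : LinearMap.rTensor R (TensorProduct.comm K V V).toLinearMap t = -t) :
    LinearMap.rTensor R (TensorProduct.comm K W W).toLinearMap
      (LinearMap.rTensor R (TensorProduct.map f f) t) =
        -LinearMap.rTensor R (TensorProduct.map f f) t := by
  rw [← LinearMap.comp_apply, ← LinearMap.rTensor_comp,
    ← TensorProduct.map_comp_comm_eq, LinearMap.rTensor_comp, LinearMap.comp_apply, ht, map_neg]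

end Wedge

section Inverse

variable {K V R ι : Type*} [CommRing K] [AddCommGroup V] [Module K V] [CommRing R] [Algebra K R]
  [Fintype ι] [DecidableEq ι] (b : Module.Basis ι K V) {B : V →ₗ[K] V →ₗ[K] R}
  (hB : IsUnit (Matrix.of fun i j => B (b i) (b j)).det)
include hB

theorem exists_eq_sum_smul_form (φ : V →ₗ[K] R) : ∃ r : ι → R, φ = ∑ i, r i • B (b i) := by
  set M := Matrix.of fun i j => B (b i) (b j)
  refine ⟨Matrix.vecMul (fun j => φ (b j)) M⁻¹, b.ext fun j => ?_⟩
  have vecMul_M : Matrix.vecMul (Matrix.vecMul (fun j => φ (b j)) M⁻¹) M = fun j => φ (b j) := by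
    rw [Matrix.vecMul_vecMul, Matrix.nonsing_inv_mul M hB, Matrix.vecMul_one]
  rw [← congrFun vecMul_M j]
  simp [Matrix.vecMul, dotProduct, LinearMap.sum_apply, M]

theorem span_range_form : Submodule.span R (Set.range B) = ⊤ := by
  rw [eq_top_iff]
  intro φ _
  obtain ⟨r, rfl⟩ := exists_eq_sum_smul_form b hB φ
  exact Submodule.sum_mem _ fun i _ => Submodule.smul_mem _ _ (Submodule.subset_span ⟨_, rfl⟩)

theorem exists_contractRight_eq :
    ∃ t : (V ⊗[K] V) ⊗[K] R, ∀ v, contractRight (B v) t = v ⊗ₜ 1 := by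
  have hB' : IsUnit (Matrix.of fun i j => B.flip (b i) (b j)).det := by
    rwa [← Matrix.det_transpose] at hB
  choose r hr using fun i => exists_eq_sum_smul_form b hB' (Algebra.linearMap K R ∘ₗ b.coord i)
  refine ⟨∑ i, ∑ j, (b i ⊗ₜ b j) ⊗ₜ r i j, fun v => ?_⟩
  have coord_eq i : ∑ j, B v (b j) * r i j = algebraMap K R (b.repr v i) := by
    simpa [LinearMap.sum_apply, mul_comm] using (LinearMap.congr_fun (hr i) v).symm
  simp only [map_sum, contractRight_tmul, ← TensorProduct.tmul_sum, coord_eq,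
    Algebra.algebraMap_eq_smul_one, TensorProduct.tmul_smul, TensorProduct.smul_tmul',
    ← TensorProduct.sum_tmul, b.sum_repr]

variable {t : (V ⊗[K] V) ⊗[K] R}

theorem eq_zero_of_contractRight (ht : ∀ v, contractRight (B v) t = 0) : t = 0 := by
  have := Module.Free.of_basis b
  have := Module.Finite.of_basis b
  refine eq_zero_of_liftCoeff (span_image2_evalTensor Submodule.span_univ
    (span_range_form b hB)) ?_
  rintro _ ⟨φ, -, _, ⟨v, rfl⟩, rfl⟩
  rw [liftCoeff_evalTensor, ht, map_zero]

theorem rTensor_comm_of_contractRight (hB' : ∀ v w, B v w = -B w v)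
    (ht : ∀ v, contractRight (B v) t = v ⊗ₜ 1) :
    LinearMap.rTensor R (TensorProduct.comm K V V).toLinearMap t = -t := by
  have := Module.Free.of_basis b
  have := Module.Finite.of_basis b
  rw [eq_neg_iff_add_eq_zero]
  refine eq_zero_of_liftCoeff (span_image2_evalTensor (span_range_form b hB)
    (span_range_form b hB)) ?_
  rintro _ ⟨_, ⟨v, rfl⟩, _, ⟨w, rfl⟩, rfl⟩
  rw [map_add, liftCoeff_rTensor, evalTensor_comp_comm, liftCoeff_evalTensor, liftCoeff_evalTensor,
    ht, ht, liftCoeff_tmul, liftCoeff_tmul, hB' v w]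
  simp

end Inverse

/-! ### The dynamical `r`-matrix -/

section DynamicalYangBaxter

variable {K g R n : Type*} [Field K] [LieRing g] [LieAlgebra K g] [CommRing R] [Algebra K R]
  [Fintype n]

/-- The map `a ⊗ b ⊗ r ↦ -∑ i, a ⊗ b ⊗ c_i ⊗ D_i(r)`, an abstract form of the differential `d^L` in
which `(D_i)` is any family of derivations of `R`. -/
def dTensor (c : n → g) (D : n → Derivation K R R) :
    (g ⊗[K] g) ⊗[K] R →ₗ[K] (g ⊗[K] (g ⊗[K] g)) ⊗[K] R :=
  -∑ i, TensorProduct.map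
    ((TensorProduct.assoc K g g g).toLinearMap ∘ₗ (TensorProduct.mk K (g ⊗[K] g) g).flip (c i))
    (D i : R →ₗ[K] R)

variable (c : n → g) (D : n → Derivation K R R) {ρ : (g ⊗[K] g) ⊗[K] R}
  (hρ : LinearMap.rTensor R (TensorProduct.comm K g g).toLinearMap ρ = -ρ)
include hρ

theorem liftCoeff_dTensor {φ ψ : g →ₗ[K] R} (χ : g →ₗ[K] R) {x y : g}
    (hφ : contractRight φ ρ = x ⊗ₜ 1) (hψ : contractRight ψ ρ = y ⊗ₜ 1) :
    liftCoeff (evalTensor φ (evalTensor ψ χ)) (dTensor c D ρ) = -∑ i, χ (c i) * D i (ψ x) := by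
  have evalTensor_comp_append i : evalTensor φ (evalTensor ψ χ) ∘ₗ
      (TensorProduct.assoc K g g g).toLinearMap ∘ₗ (TensorProduct.mk K (g ⊗[K] g) g).flip (c i) =
        χ (c i) • evalTensor φ ψ :=
    TensorProduct.ext' fun a b => by
      simp only [LinearMap.coe_comp, LinearEquiv.coe_coe, Function.comp_apply,
        LinearMap.flip_apply, TensorProduct.mk_apply, TensorProduct.assoc_tmul, evalTensor_tmul,
        LinearMap.smul_apply, smul_eq_mul]
      ring
  rw [dTensor, LinearMap.neg_apply, map_neg, LinearMap.sum_apply, map_sum]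
  congr! 2 with i
  rw [← LinearMap.rTensor_comp_lTensor, LinearMap.comp_apply, liftCoeff_rTensor,
    evalTensor_comp_append, map_smul, LinearMap.smul_apply,
    liftCoeff_evalTensor_lTensor hρ _ hφ hψ, smul_eq_mul]

theorem liftCoeff_cdybe [LieBialgebra K g] {φ ψ χ : g →ₗ[K] R} {x y z : g}
    (hφ : contractRight φ ρ = x ⊗ₜ 1) (hψ : contractRight ψ ρ = y ⊗ₜ 1)
    (hχ : contractRight χ ρ = z ⊗ₜ 1) :
    liftCoeff (evalTensor φ (evalTensor ψ χ)) (CYB ρ +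
        LinearMap.rTensor R (alt K g) (dTensor c D ρ) +
        LinearMap.rTensor R (alt K g ∘ₗ tensorId (cobracket (K := K))) ρ) =
      (φ ⁅y, z⁆ + ψ ⁅z, x⁆ + χ ⁅x, y⁆) -
      (∑ i, χ (c i) * D i (ψ x) + ∑ i, ψ (c i) * D i (φ z) + ∑ i, φ (c i) * D i (χ y)) +
      (evalTensor φ ψ (cobracket z) + evalTensor χ φ (cobracket y) +
        evalTensor ψ χ (cobracket x)) := by
  have liftCoeff_tensorId {φ ψ χ : g →ₗ[K] R} {z : g} (hχ : contractRight χ ρ = z ⊗ₜ 1) :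
      liftCoeff (evalTensor φ (evalTensor ψ χ) ∘ₗ tensorId (cobracket (K := K))) ρ =
        evalTensor φ ψ (cobracket z) := by
    rw [evalTensor_comp_tensorId, liftCoeff_evalTensor, hχ, liftCoeff_tmul, mul_one,
      LinearMap.comp_apply]
  rw [map_add, map_add, liftCoeff_CYB hρ hφ hψ hχ, liftCoeff_rTensor, liftCoeff_rTensor,
    ← LinearMap.comp_assoc, evalTensor_comp_alt, LinearMap.add_comp, LinearMap.add_comp]
  simp only [map_add, LinearMap.add_apply]
  rw [liftCoeff_dTensor c D hρ χ hφ hψ, liftCoeff_dTensor c D hρ ψ hχ hφ,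
    liftCoeff_dTensor c D hρ φ hψ hχ, liftCoeff_tensorId hχ, liftCoeff_tensorId hψ,
    liftCoeff_tensorId hφ]
  ring

end DynamicalYangBaxter

namespace IsSplitting

section TestFunctional

variable {K g : Type*} [Field K] [CharZero K] [LieRing g] [LieAlgebra K g] [LieBialgebra K g]
  {l : LieSubbialgebra K g} {u : Submodule K g} (s : IsSplitting l u)
  (R : Type*) [CommRing R] [Algebra K R] [Algebra (DualFun l) R] [IsScalarTower K (DualFun l) R]

/-- The form `ω` on `g` with values in an algebra `R` over `K[[L^*]]`, such as `K[[L^*]][1/P]`. -/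
def omegaLoc : g →ₗ[K] g →ₗ[K] R :=
  s.omegaG.compr₂ ((Algebra.linearMap (DualFun l) R).restrictScalars K)

theorem omegaLoc_apply (x y : g) : s.omegaLoc R x y = algebraMap _ R (s.omegaG x y) :=
  rfl

theorem omegaLoc_swap (x y : g) : s.omegaLoc R x y = -s.omegaLoc R y x := by
  rw [omegaLoc_apply, omegaG_swap, map_neg, omegaLoc_apply]

theorem evalTensor_omegaLoc (x y : g) (t : g ⊗[K] g) :
    evalTensor (s.omegaLoc R x) (s.omegaLoc R y) t =
      algebraMap _ R (evalTensor (s.omegaG x) (s.omegaG y) t) :=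
  LinearMap.congr_fun (TensorProduct.ext' fun _ _ => (map_mul (algebraMap (DualFun l) R) _ _).symm :
    evalTensor (s.omegaLoc R x) (s.omegaLoc R y) =
      (Algebra.linearMap (DualFun l) R).restrictScalars K ∘ₗ
        evalTensor (s.omegaG x) (s.omegaG y)) t

theorem isUnit_det_omegaLoc {ι : Type*} [Fintype ι] [DecidableEq ι] (b : Module.Basis ι K u)
    (hP : IsUnit (algebraMap _ R (s.detOmega b))) :
    IsUnit (Matrix.of fun i j => (s.omegaLoc R).compl₁₂ u.subtype u.subtype (b i) (b j)).det := by
  have det_eq : (Matrix.of fun i j =>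
      (s.omegaLoc R).compl₁₂ u.subtype u.subtype (b i) (b j)).det =
        algebraMap _ R (s.detOmega b) :=
    (RingHom.map_det (algebraMap _ R) (Matrix.of fun i j => s.omega (b i) (b j))).symm
  rwa [det_eq]

/-- The functional `ω(v, ·) + ξ` on `g`, for `v ∈ u` and `ξ ∈ l^*`. The identities satisfied by the
inverse `σ` of `ω` are tested on these functionals: they span all functionals, and their contraction
with `σ` is `v`. -/
def testFunctional (v : u) (ξ : LieDual K l.toLieSubalgebra) : g →ₗ[K] R :=
  s.omegaLoc R v + constDual R (s.extendDual ξ)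

theorem testFunctional_of_mem_u (v : u) (ξ : LieDual K l.toLieSubalgebra) {y : g} (hy : y ∈ u) :
    s.testFunctional R v ξ y = s.omegaLoc R v y := by
  rw [testFunctional, LinearMap.add_apply, constDual_apply, s.extendDual_of_mem_u ξ hy, map_zero,
    add_zero]

theorem testFunctional_coe (v : u) (ξ : LieDual K l.toLieSubalgebra) (a : l.toLieSubalgebra) :
    s.testFunctional R v ξ (a : g) = algebraMap K R (toDual ξ a) := by
  rw [testFunctional, LinearMap.add_apply, constDual_apply, extendDual_coe, omegaLoc_apply,
    s.omegaG_u_l v.2, map_zero, zero_add]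

theorem contractRight_testFunctional {σ : (u ⊗[K] u) ⊗[K] R} {v : u}
    (hσ : contractRight ((s.omegaLoc R).compl₁₂ u.subtype u.subtype v) σ = v ⊗ₜ 1)
    (ξ : LieDual K l.toLieSubalgebra) :
    contractRight (s.testFunctional R v ξ)
      (LinearMap.rTensor R (TensorProduct.mapIncl u u) σ) = (v : g) ⊗ₜ 1 := by
  have testFunctional_comp_subtype : s.testFunctional R v ξ ∘ₗ u.subtype =
      (s.omegaLoc R).compl₁₂ u.subtype u.subtype v :=
    LinearMap.ext fun y => s.testFunctional_of_mem_u R v ξ y.2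
  rw [TensorProduct.mapIncl, contractRight_rTensor_map, testFunctional_comp_subtype, hσ,
    LinearMap.rTensor_tmul, Submodule.subtype_apply]

theorem evalTensor_testFunctional (x y : u) (ξ η : LieDual K l.toLieSubalgebra) {z : g}
    (hz : z ∈ u) :
    evalTensor (s.testFunctional R x ξ) (s.testFunctional R y η) (cobracket z) =
      evalTensor (s.omegaLoc R x) (s.omegaLoc R y) (cobracket z) +
        s.omegaLoc R y (s.coadL ξ z) - s.omegaLoc R x (s.coadL η z) := by
  have eval_constDual_left (ξ : LieDual K l.toLieSubalgebra) (φ : g →ₗ[K] R) :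
      evalTensor (constDual R (s.extendDual ξ)) φ (cobracket z) = φ (s.coadL ξ z) := by
    rw [evalTensor_constDual_left]
    rfl
  have eval_constDual_constDual :
      constDual R (s.extendDual η) (s.coadL ξ z) = 0 := by
    rw [constDual_apply, s.extendDual_of_mem_u η (s.coadL_mem_u ξ hz), map_zero]
  simp only [testFunctional, map_add, LinearMap.add_apply]
  rw [eval_constDual_left, eval_constDual_left, eval_constDual_constDual,
    evalTensor_cobracket_swap _ (constDual R (s.extendDual η)), eval_constDual_left]
  ring

variable [FiniteDimensional K g]

theorem span_testFunctional {ι : Type*} [Fintype ι] [DecidableEq ι] (b : Module.Basis ι K u)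
    (hP : IsUnit (algebraMap _ R (s.detOmega b))) :
    Submodule.span R (Set.range fun p : u × LieDual K l.toLieSubalgebra =>
      s.testFunctional R p.1 p.2) = ⊤ := by
  rw [eq_top_iff]
  intro φ _
  obtain ⟨r, hr⟩ := exists_eq_sum_smul_form b (s.isUnit_det_omegaLoc R b hP) (φ ∘ₗ u.subtype)
  let e := stdBasis K l.toLieSubalgebra
  let φ' : g →ₗ[K] R := ∑ i, r i • s.testFunctional R (b i) 0 +
    ∑ i, φ (e i) • s.testFunctional R 0 (dualVec K l.toLieSubalgebra i)
  have eq_on_u {y : g} (hy : y ∈ u) : φ y = φ' y := by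
    have hry := LinearMap.congr_fun hr ⟨y, hy⟩
    simpa [φ', LinearMap.sum_apply, s.testFunctional_of_mem_u R _ _ hy] using hry
  have eq_on_l (a : l.toLieSubalgebra) : φ (a : g) = φ' a := by
    refine LinearMap.congr_fun (e.ext fun j => ?_ :
      φ ∘ₗ l.toLieSubalgebra.toSubmodule.subtype = φ' ∘ₗ l.toLieSubalgebra.toSubmodule.subtype) a
    have dualVec_apply i : toDual (dualVec K l.toLieSubalgebra i) (e j) = if j = i then 1 else 0 :=
      e.repr_self_apply j i
    change φ (e j : g) = φ' (e j)
    simp [φ', LinearMap.sum_apply, testFunctional_coe, dualVec_apply]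
  have φ_eq : φ = φ' := LinearMap.ext fun x => by
    have hx : x ∈ l.toLieSubalgebra.toSubmodule ⊔ u := s.isCompl.sup_eq_top ▸ Submodule.mem_top
    obtain ⟨a, ha, y, hy, rfl⟩ := Submodule.mem_sup.1 hx
    rw [map_add, map_add, eq_on_u hy, eq_on_l ⟨a, ha⟩]
  have smul_mem (r : R) (v : u) (ξ : LieDual K l.toLieSubalgebra) :=
    Submodule.smul_mem _ r (Submodule.subset_span (R := R) (Set.mem_range_self (f := fun p :
      u × LieDual K l.toLieSubalgebra => s.testFunctional R p.1 p.2) (v, ξ)))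
  rw [φ_eq]
  exact add_mem (sum_mem fun i _ => smul_mem _ _ _) (sum_mem fun i _ => smul_mem _ _ _)

end TestFunctional

section Contraction

variable {K g : Type*} [Field K] [CharZero K] [LieRing g] [LieAlgebra K g] [LieBialgebra K g]
  [FiniteDimensional K g] {l : LieSubbialgebra K g} {u : Submodule K g} {s : IsSplitting l u}
  {R : Type*} [CommRing R] [Algebra K R] [Algebra (DualFun l) R] [IsScalarTower K (DualFun l) R]

section Derivation

variable {D : Fin (Module.finrank K l.toLieSubalgebra) → Derivation K R R}
  (hD : ∀ i (f : DualFun l), D i (algebraMap _ R f) =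
    algebraMap _ R (leftTrans (K := K) (dualVec K l.toLieSubalgebra i) f))
include hD

theorem sum_testFunctional_mul (v : u) (ξ : LieDual K l.toLieSubalgebra) (f : DualFun l) :
    ∑ i, s.testFunctional R v ξ (stdBasis K l.toLieSubalgebra i : g) * D i (algebraMap _ R f) =
      algebraMap _ R (leftTrans (K := K) ξ f) := by
  have leftTrans_eq_sum : leftTrans (K := K) ξ f =
      ∑ i, toDual ξ (stdBasis K l.toLieSubalgebra i) •
        leftTrans (K := K) (dualVec K l.toLieSubalgebra i) f :=
    WithConv.ofConv_injective <| LinearMap.ext fun X => by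
      conv_lhs => rw [← sum_dualVec ξ]
      simp [leftTrans_apply, Finset.sum_mul, -UniversalEnvelopingAlgebra.ι_apply]
  simp only [testFunctional_coe, hD, leftTrans_eq_sum, map_sum, Algebra.smul_def, map_mul,
    ← IsScalarTower.algebraMap_apply]

theorem sum_testFunctional_mul_testFunctional (x y z : u) (η ζ : LieDual K l.toLieSubalgebra) :
    ∑ i, s.testFunctional R z ζ (stdBasis K l.toLieSubalgebra i : g) *
      D i (s.testFunctional R y η x) =
    -s.omegaLoc R (s.coadL ζ y) x - s.omegaLoc R y (s.coadL ζ x) +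
      constDual R (s.extendDual ζ) ⁅(x : g), (y : g)⁆ := by
  rw [s.testFunctional_of_mem_u R y η x.2, omegaLoc_apply, sum_testFunctional_mul hD,
    leftTrans_omegaG, map_add, map_sub, map_neg, ← IsScalarTower.algebraMap_apply]
  rfl

end Derivation

variable {ρ : (g ⊗[K] g) ⊗[K] R}
  (hρ : LinearMap.rTensor R (TensorProduct.comm K g g).toLinearMap ρ = -ρ)
  (contract_ρ : ∀ (v : u) (ξ : LieDual K l.toLieSubalgebra),
    contractRight (s.testFunctional R v ξ) ρ = (v : g) ⊗ₜ 1)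
  (hspan : Submodule.span R (Set.range fun p : u × LieDual K l.toLieSubalgebra =>
    s.testFunctional R p.1 p.2) = ⊤)
include hρ contract_ρ hspan

theorem equivariant_of_contractRight {a : l.toLieSubalgebra} {D : Derivation K R R}
    (hD : ∀ f : DualFun l, D (algebraMap _ R f) = algebraMap _ R (dressL (K := K) a f)) :
    LinearMap.lTensor (g ⊗[K] g) (D : R →ₗ[K] R) ρ +
      LinearMap.rTensor R (LieModule.toEnd K g (g ⊗[K] g) (a : g)) ρ = 0 := by
  refine eq_zero_of_liftCoeff (span_image2_evalTensor hspan hspan) ?_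
  rintro _ ⟨_, ⟨⟨v, ξ⟩, rfl⟩, _, ⟨⟨w, η⟩, rfl⟩, rfl⟩
  have lie_mem (x : u) : ⁅(a : g), (x : g)⁆ ∈ u := s.lie_mem a a.2 x x.2
  have D_omega : D (s.omegaLoc R w v) =
      s.omegaLoc R ⁅(a : g), (w : g)⁆ v + s.omegaLoc R w ⁅(a : g), (v : g)⁆ := by
    rw [omegaLoc_apply, hD, dressL_eq, Derivation.neg_apply, s.dressD_omegaG a w.2 v.2, neg_sub,
      sub_neg_eq_add, map_add, add_comm]
    rfl
  rw [map_add, liftCoeff_evalTensor_lTensor hρ D (contract_ρ v ξ) (contract_ρ w η),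
    liftCoeff_evalTensor_toEnd hρ a (contract_ρ v ξ) (contract_ρ w η)]
  simp only [s.testFunctional_of_mem_u R _ _ v.2, s.testFunctional_of_mem_u R _ _ (lie_mem _)]
  rw [D_omega, s.omegaLoc_swap R v]
  ring

theorem cdybe_of_contractRight
    {D : Fin (Module.finrank K l.toLieSubalgebra) → Derivation K R R}
    (hD : ∀ i (f : DualFun l), D i (algebraMap _ R f) =
      algebraMap _ R (leftTrans (K := K) (dualVec K l.toLieSubalgebra i) f)) :
    CYB ρ + LinearMap.rTensor R (alt K g)
      (dTensor (fun i => (stdBasis K l.toLieSubalgebra i : g)) D ρ) +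
      LinearMap.rTensor R (alt K g ∘ₗ tensorId (cobracket (K := K))) ρ = 0 := by
  refine eq_zero_of_liftCoeff (span_image2_evalTensor hspan (span_image2_evalTensor hspan hspan)) ?_
  rintro _ ⟨_, ⟨⟨x, ξ⟩, rfl⟩, _, ⟨_, ⟨⟨y, η⟩, rfl⟩, _, ⟨⟨z, ζ⟩, rfl⟩, rfl⟩, rfl⟩
  have closed := congrArg (algebraMap _ R) (s.omegaCyc_eq_zero x y z)
  simp only [omegaCyc, map_add, map_zero, ← omegaLoc_apply, ← evalTensor_omegaLoc] at closed
  rw [liftCoeff_cdybe _ D hρ (contract_ρ x ξ) (contract_ρ y η) (contract_ρ z ζ)]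
  simp only [sum_testFunctional_mul_testFunctional hD, s.evalTensor_testFunctional R _ _ _ _ x.2,
    s.evalTensor_testFunctional R _ _ _ _ y.2, s.evalTensor_testFunctional R _ _ _ _ z.2]
  rw [s.omegaLoc_swap R (s.coadL ζ y), s.omegaLoc_swap R (s.coadL η x),
    s.omegaLoc_swap R (s.coadL ξ z)]
  simp only [testFunctional, LinearMap.add_apply]
  linear_combination closed

end Contraction

variable {K g : Type*} [Field K] [CharZero K] [LieRing g] [LieAlgebra K g] [LieBialgebra K g]
  {l : LieSubbialgebra K g} {u : Submodule K g} (s : IsSplitting l u)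

theorem contract_eq_contractRight (P : DualFun l) (v : u) :
    s.contract P v =
      contractRight ((s.omegaLoc (Localization.Away P)).compl₁₂ u.subtype u.subtype v) :=
  rfl

variable [FiniteDimensional K g]

theorem isPLDynamicalRMatrix_of_isInverse (hs : s.Nondegenerate) {ι : Type*} [Fintype ι]
    [DecidableEq ι] (b : Module.Basis ι K u)
    (σ : wedge2 K u ⊗[K] Localization.Away (s.detOmega b))
    (hσ : s.IsInverse (s.detOmega b) (LinearMap.rTensor _ (wedge2 K u).subtype σ)) :
    IsPLDynamicalRMatrix l 0 (s.detOmega b)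
      (LinearMap.rTensor _ (TensorProduct.mapIncl u u ∘ₗ (wedge2 K u).subtype) σ) := by
  rw [LinearMap.rTensor_comp, LinearMap.comp_apply]
  have hρ := rTensor_comm_rTensor_map u.subtype (mem_range_rTensor_wedge2.1 ⟨σ, rfl⟩)
  have contract_ρ v := s.contractRight_testFunctional _ (hσ v)
  have hspan := s.span_testFunctional (Localization.Away (s.detOmega b)) b
    (IsLocalization.Away.algebraMap_isUnit _)
  refine ⟨s.detOmega_ne_zero hs b, mem_range_rTensor_wedge2.2 hρ, fun a => ?_, ?_⟩
  · have hD := extendDer_algebraMap (dressL a) (s.detOmega b)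
    exact equivariant_of_contractRight hρ contract_ρ hspan hD
  · have hD i :=
      extendDer_algebraMap (leftTrans (K := K) (dualVec K l.toLieSubalgebra i)) (s.detOmega b)
    have cdybe := cdybe_of_contractRight hρ contract_ρ hspan hD
    exact cdybe.trans (TensorProduct.zero_tmul _ _).symm

end IsSplitting

end PLDyn

end

theorem mainTheorem1 {K g : Type*} [Field K] [CharZero K] [LieRing g] [LieAlgebra K g]
    [FiniteDimensional K g] [PLDyn.LieBialgebra K g]
    (l : PLDyn.LieSubbialgebra K g) (u : Submodule K g) (s : PLDyn.IsSplitting l u)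
    (hs : s.Nondegenerate)
    {ι : Type*} [Fintype ι] [DecidableEq ι] (b : Module.Basis ι K u) :
    ∃ σ : PLDyn.wedge2 K u ⊗[K] Localization.Away (s.detOmega b),
      s.IsInverse (s.detOmega b) (LinearMap.rTensor _ (PLDyn.wedge2 K u).subtype σ) ∧
      (∀ τ, s.IsInverse (s.detOmega b) τ →
        τ = LinearMap.rTensor _ (PLDyn.wedge2 K u).subtype σ) ∧
      PLDyn.IsPLDynamicalRMatrix l 0 (s.detOmega b)
        (LinearMap.rTensor _ (TensorProduct.mapIncl u u ∘ₗ (PLDyn.wedge2 K u).subtype) σ) := by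
  have hdet := s.isUnit_det_omegaLoc (Localization.Away (s.detOmega b)) b
    (IsLocalization.Away.algebraMap_isUnit (s.detOmega b))
  obtain ⟨t, ht⟩ := PLDyn.exists_contractRight_eq b hdet
  have t_antisymm := PLDyn.rTensor_comm_of_contractRight b hdet
    (fun v w => s.omegaLoc_swap _ (v : g) (w : g)) ht
  obtain ⟨σ, rfl⟩ := PLDyn.mem_range_rTensor_wedge2.2 t_antisymm
  have σ_inverse : s.IsInverse (s.detOmega b) (LinearMap.rTensor _ (PLDyn.wedge2 K u).subtype σ) :=
    fun v => by rw [s.contract_eq_contractRight, ht]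
  refine ⟨σ, σ_inverse, fun τ τ_inverse => ?_, s.isPLDynamicalRMatrix_of_isInverse hs b σ σ_inverse⟩
  rw [← sub_eq_zero]
  refine PLDyn.eq_zero_of_contractRight b hdet fun v => ?_
  rw [map_sub, ht, ← s.contract_eq_contractRight, τ_inverse, sub_self]
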